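/- Let $\mathbb{K}=\mathbb{R}$ or $\mathbb{C}$, and let $E$ be a separable F-space over $\mathbb{K}$ (a topological vector space whose topology is induced by a complete translation-invariant metric) that is locally bounded (some neighbourhood of $0$ is bounded) or locally convex. Let $T:E\to E$ be a continuous linear operator that satisfies the Frequent Hypercyclicity Criterion: there are a dense set $E_0\subseteq E$ and a map $S:E_0\to E_0$ such that, for every $y\in E_0$, the series $\sum_{n\ge 0}T^n y$ and $\sum_{n\ge 0}S^n y$ converge unconditionally in $E$ and $TSy=y$. Then there exist a supercyclic vector $x$ for $T$ (that is, $\{\lambda T^n x: n\ge 0,\ \lambda\in\mathbb{K}\}$ is dense in $E$), a sequence $(u_n)_{n\ge 0}$ in $E$ with $u_0=x$ and $Tu_n=u_{n-1}$ for every $n\ge 1$, and a $\mathbb{K}$-valued random variable $X$ with full support (every nonempty open subset of $\mathbb{K}$ has positive probability under the law of $X$) such that, whenever $(X_n)_{n\in\mathbb{Z}}$ is a sequence of independent copies of $X$ on a probability space, the following holds. Almost surely both series in $$v:=\sum_{n=0}^{\infty}X_nT^n x+\sum_{n=1}^{\infty}X_{-n}u_n$$ converge in $E$, so that $v$ is an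 almost surely well-defined random vector; almost surely $v$ is frequently hypercyclic for $T$, that is, for every nonempty open set $U\subseteq E$, $$\liminf_{N\to\infty}\frac{\#\{0\le n\le N: T^n v\in U\}}{N+1}>0;$$ and the law $\mu$ of $v$, a Borel probability measure on $E$, is $T$-invariant, strongly mixing for $T$ (that is, $\mu(A\cap T^{-n}B)\to\mu(A)\mu(B)$ as $n\to\infty$ for all Borel sets $A,B\subseteq E$), and has full support (every nonempty open subset of $E$ has positive $\mu$-measure). -/

import Mathlib

open Filter Topology MeasureTheory ProbabilityTheory

/-- A topological vector space is locally bounded if some neighbourhood of `0` is bounded, that is,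
absorbed by every neighbourhood of `0`. -/
def IsLocallyBoundedTVS (𝕜 E : Type*) [RCLike 𝕜] [AddCommGroup E] [Module 𝕜 E]
    [TopologicalSpace E] : Prop :=
  ∃ U ∈ 𝓝 (0 : E), Bornology.IsVonNBounded 𝕜 U

/-- The lower density `liminf_N #{n ∈ A : n ≤ N} / (N + 1)` of a set of natural numbers. -/
noncomputable def lowerDensity (A : Set ℕ) : ℝ :=
  liminf (fun N : ℕ => ((A ∩ Set.Iic N).ncard : ℝ) / ((N : ℝ) + 1)) atTop

section Operators

variable {𝕜 E : Type*} [RCLike 𝕜] [AddCommGroup E] [Module 𝕜 E] [TopologicalSpace E]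

/-- A vector `x` is frequently hypercyclic for `T` if its orbit visits every nonempty open set along
a set of times of positive lower density. -/
def IsFreqHypercyclicVector (T : E →L[𝕜] E) (x : E) : Prop :=
  ∀ U : Set E, IsOpen U → U.Nonempty → 0 < lowerDensity {n : ℕ | (T ^ n) x ∈ U}

/-- A vector `x` is supercyclic for `T` if the scalar multiples of its orbit are dense. -/
def IsSupercyclicVector (T : E →L[𝕜] E) (x : E) : Prop :=
  Dense {y : E | ∃ (c : 𝕜) (n : ℕ), y = c • (T ^ n) x}

/-- `T` satisfies the Frequent Hypercyclicity Criterion: there are a dense set `E₀` and a self-map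
`S` of `E₀` (not assumed linear or continuous) such that, for every `y ∈ E₀`, both series
`∑ Tⁿ y` and `∑ Sⁿ y` converge unconditionally and `T (S y) = y`. -/
def SatisfiesFHCriterion (T : E →L[𝕜] E) : Prop :=
  ∃ E₀ : Set E, Dense E₀ ∧ ∃ S : E₀ → E₀, ∀ y : E₀,
    Summable (fun n : ℕ => (T ^ n) (y : E)) ∧
    Summable (fun n : ℕ => ((S^[n] y : E₀) : E)) ∧
    T (S y : E) = (y : E)

end Operators

/-- The transformation `f` preserves `μ` and is strongly mixing for it. -/
def IsStronglyMixing {α : Type*} [MeasurableSpace α] (f : α → α) (μ : Measure α) : Prop :=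
  MeasurePreserving f μ μ ∧
    ∀ A B : Set α, MeasurableSet A → MeasurableSet B →
      Tendsto (fun n : ℕ => μ (A ∩ f^[n] ⁻¹' B)) atTop (𝓝 (μ A * μ B))

/-- Both one-sided series `∑_{n ≥ 0} aₙ` and `∑_{n ≥ 1} bₙ` converge, in the sense of the
convergence of their partial sums, and the sum of the two limits is `s`. -/
def IsTwoSidedSum {E : Type*} [AddCommMonoid E] [TopologicalSpace E] (a b : ℕ → E) (s : E) : Prop :=
  ∃ y z : E, Tendsto (fun N : ℕ => ∑ n ∈ Finset.range N, a n) atTop (𝓝 y) ∧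
    Tendsto (fun N : ℕ => ∑ n ∈ Finset.Icc 1 N, b n) atTop (𝓝 z) ∧ s = y + z

/-!
A bilateral orbit of `T` is a family `z : ℤ → E` with `T (z n) = z (n + 1)`. If the random series
`v = ∑ Xₙ zₙ` with independent identically distributed coefficients converges almost surely, then
`T v` is the same series for the shifted coefficients, so that `T` with the law of `v` is a factor
of a Bernoulli shift, and hence strongly mixing (`isStronglyMixing_bilateralShift`,
`IsStronglyMixing.factor`). Under a strongly mixing transformation almost every orbit visits a given
set of positive measure with positive lower density (`IsStronglyMixing.ae_lowerDensity_pos`, by a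
covering argument that replaces the pointwise ergodic theorem). So once the law of `v` has full
support, `v` is almost surely frequently hypercyclic.

It remains to find `z` and the law of the coefficients. Local boundedness or local convexity enters
through `exists_norm_sum_smul_lt_of_subset_sums`: unconditional convergence becomes convergence
that is uniform over multipliers from the unit ball (`IsMultiplierSummable`). The Frequent
Hypercyclicity Criterion gives summable bilateral orbits `w k` through the vectors `w k 0` of a
dense sequence. Put `z n = ∑ₖ c k • w k (n - m k)` with `c k` decaying fast and then `m k` growing
fast. As the set of the bounded-multiplier sums of `w k` is bounded and does not notice the shift by
`m k`, the family `z` is again multiplier summable; and `(c k)⁻¹ • z (m k)` is close to `w k 0`,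
because the later terms are killed by the decay of `c` and the earlier ones by the time elapsed
(`SatisfiesFHCriterion.exists_multiplierSummable_orbit`). In particular `x = z 0` is supercyclic.

A multiplier summable family stays so after multiplication by suitable weights tending to infinity
(`IsMultiplierSummable.exists_weights`). A fully supported law whose tails are small relative to
these weights makes the coefficients eventually dominated by them, by the Borel–Cantelli lemma, so
that the series converges almost surely; and `v` is close to a prescribed `c • z n` with positive
probability (`isOpenPosMeasure_map_bilateralSeries`).
-/

/-! ### Frequent visits under a strongly mixing transformation -/

/-- The number of times `0 ≤ i < L` at which the orbit of `y` under `f` is in `A`. -/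
noncomputable def visitCount {α : Type*} (f : α → α) (A : Set α) (L : ℕ) (y : α) : ℝ :=
  ∑ i ∈ Finset.range L, A.indicator (fun _ => (1 : ℝ)) (f^[i] y)

section VisitCount

variable {α : Type*} {f : α → α} {A : Set α}

lemma visitCount_nonneg (L : ℕ) (y : α) : 0 ≤ visitCount f A L y :=
  Finset.sum_nonneg fun _ _ => Set.indicator_nonneg (fun _ _ => zero_le_one) _

lemma visitCount_le (L : ℕ) (y : α) : visitCount f A L y ≤ L := by
  unfold visitCount
  calc _ ≤ ∑ i ∈ Finset.range L, (1 : ℝ) :=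
        Finset.sum_le_sum fun _ _ => Set.indicator_le_self' (fun _ _ => zero_le_one) _
    _ = L := by simp

lemma visitCount_add (a b : ℕ) (y : α) :
    visitCount f A (a + b) y = visitCount f A a y + visitCount f A b (f^[a] y) := by
  simp only [visitCount, Finset.sum_range_add]
  congr 1
  refine Finset.sum_congr rfl fun i _ => ?_
  rw [← Function.iterate_add_apply, add_comm]

lemma visitCount_mono_set {B : Set α} (h : A ⊆ B) (L : ℕ) (y : α) :
    visitCount f A L y ≤ visitCount f B L y :=
  Finset.sum_le_sum fun _ _ =>
    Set.indicator_le_indicator_of_subset h (fun _ => zero_le_one) _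

lemma ncard_visits (N : ℕ) (y : α) :
    (({n : ℕ | f^[n] y ∈ A} ∩ Set.Iic N).ncard : ℝ) = visitCount f A (N + 1) y := by
  classical
  have : ({n : ℕ | f^[n] y ∈ A} ∩ Set.Iic N) =
      ((Finset.range (N + 1)).filter fun n => f^[n] y ∈ A : Finset ℕ) := by
    ext n
    simp [and_comm]
  rw [this, Set.ncard_coe_finset, visitCount, Finset.card_filter]
  push_cast
  exact Finset.sum_congr rfl fun i _ => by simp [Set.indicator_apply]

/-- If from every point the orbit starts with a block of length at most `M` in which the frequency
of visits to `A` is at most `ε`, then cutting a long orbit segment into such blocks bounds the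
number of visits in it. -/
lemma visitCount_le_of_blocks {ε : ℝ} (hε : 0 ≤ ε) {M : ℕ}
    (h : ∀ y, ∃ l, 1 ≤ l ∧ l ≤ M ∧ visitCount f A l y ≤ ε * l) (L : ℕ) :
    ∀ y, visitCount f A L y ≤ ε * L + M := by
  induction L using Nat.strong_induction_on with
  | _ L ih =>
    intro y
    by_cases hL : L ≤ M
    · have h1 : (L : ℝ) ≤ M := by exact_mod_cast hL
      have h2 := visitCount_le (f := f) (A := A) L y
      have h3 : 0 ≤ ε * L := by positivity
      linarith
    · obtain ⟨l, hl1, hlM, hl⟩ := h y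
      obtain ⟨r, rfl⟩ := Nat.exists_eq_add_of_le (show l ≤ L by omega)
      rw [visitCount_add]
      have := ih r (by omega) (f^[l] y)
      push_cast
      linarith

end VisitCount

section Measure

variable {α : Type*} [MeasurableSpace α] {f : α → α} {A : Set α} {μ : Measure α}

lemma measurable_visitCount (hf : Measurable f) (hA : MeasurableSet A) (L : ℕ) :
    Measurable (visitCount f A L) :=
  Finset.measurable_sum _ fun i _ => (measurable_const.indicator hA).comp (hf.iterate i)

lemma integral_visitCount [IsProbabilityMeasure μ] (hf : MeasurePreserving f μ μ)
    (hA : MeasurableSet A) (L : ℕ) : ∫ y, visitCount f A L y ∂μ = L * μ.real A := by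
  have hint : Integrable (A.indicator fun _ => (1 : ℝ)) μ :=
    (integrable_const _).indicator hA
  have h1 : ∀ i, ∫ y, A.indicator (fun _ => (1 : ℝ)) (f^[i] y) ∂μ = μ.real A := fun i => by
    have hi := hf.iterate i
    rw [← integral_indicator_one hA]
    have := integral_map (μ := μ) (φ := f^[i]) hi.measurable.aemeasurable
      (f := A.indicator fun _ => (1 : ℝ)) (by rw [hi.map_eq]; exact hint.aestronglyMeasurable)
    rw [hi.map_eq] at this
    exact this.symm
  unfold visitCount
  rw [integral_finsetSum]
  · simp [h1]
  · intro i _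
    exact (hf.iterate i).integrable_comp_of_integrable hint

lemma measureReal_le_of_blocks [IsProbabilityMeasure μ] (hf : MeasurePreserving f μ μ)
    (hA : MeasurableSet A) {ε : ℝ} (hε : 0 ≤ ε) {M : ℕ}
    (h : ∀ y, ∃ l, 1 ≤ l ∧ l ≤ M ∧ visitCount f A l y ≤ ε * l) : μ.real A ≤ ε := by
  have key : ∀ L : ℕ, (L : ℝ) * μ.real A ≤ ε * L + M := fun L => by
    rw [← integral_visitCount hf hA L]
    calc ∫ y, visitCount f A L y ∂μ ≤ ∫ _, (ε * L + M) ∂μ := by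
          refine integral_mono ?_ (integrable_const _) fun y => visitCount_le_of_blocks hε h L y
          refine Integrable.of_bound (C := L)
            (measurable_visitCount hf.measurable hA L).aestronglyMeasurable
            (Eventually.of_forall fun y => ?_)
          rw [Real.norm_of_nonneg (visitCount_nonneg L y)]
          exact visitCount_le L y
      _ = ε * L + M := by simp
  by_contra! hlt
  obtain ⟨L, hL⟩ := exists_nat_gt (M / (μ.real A - ε))
  rw [div_lt_iff₀ (by linarith)] at hL
  linarith [key L]

/-- The part of `A` from which some initial orbit segment has frequency of visits to `A` at most
`ε` has measure at most `ε`. -/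
lemma measureReal_inter_visitCount_le [IsProbabilityMeasure μ] (hf : MeasurePreserving f μ μ)
    (hA : MeasurableSet A) {ε : ℝ} (hε : 0 ≤ ε) :
    μ.real (A ∩ {y | ∃ N : ℕ, 1 ≤ N ∧ visitCount f A N y ≤ ε * N}) ≤ ε := by
  set Z : ℕ → Set α := fun M => {y | ∃ N : ℕ, N ≤ M ∧ 1 ≤ N ∧ visitCount f A N y ≤ ε * N} with hZ
  have hmono : Monotone fun M => A ∩ Z M := fun M M' hM y hy =>
    ⟨hy.1, by obtain ⟨N, h1, h2⟩ := hy.2; exact ⟨N, h1.trans hM, h2⟩⟩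
  have hUn : A ∩ {y | ∃ N : ℕ, 1 ≤ N ∧ visitCount f A N y ≤ ε * N} = ⋃ M, A ∩ Z M := by
    ext y
    simp only [hZ, Set.mem_inter_iff, Set.mem_ofPred_eq, Set.mem_iUnion]
    constructor
    · rintro ⟨h1, N, h2⟩
      exact ⟨N, h1, N, le_rfl, h2⟩
    · rintro ⟨M, h1, N, -, h2⟩
      exact ⟨h1, N, h2⟩
  have hlim := tendsto_measure_iUnion_atTop (μ := μ) hmono
  rw [hUn]
  have hlim' := (ENNReal.tendsto_toReal (measure_ne_top μ _)).comp hlim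
  refine le_of_tendsto' hlim' fun M => ?_
  have hZm : MeasurableSet (Z M) := by
    have : Z M = ⋃ N : ℕ, ⋃ _ : N ≤ M ∧ 1 ≤ N, {y | visitCount f A N y ≤ ε * N} := by
      ext y; simp [hZ, and_assoc]
    rw [this]
    exact MeasurableSet.iUnion fun N => MeasurableSet.iUnion fun _ =>
      measurableSet_le (measurable_visitCount hf.measurable hA N) measurable_const
  -- outside `Z M` a block of length one will do, as it contains no visit to `A ∩ Z M`
  refine measureReal_le_of_blocks (M := M + 1) hf (hA.inter hZm) hε fun y => ?_
  by_cases hy : y ∈ Z M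
  · obtain ⟨N, h1, h2, h3⟩ := hy
    exact ⟨N, h2, by omega, (visitCount_mono_set Set.inter_subset_left N y).trans h3⟩
  · refine ⟨1, le_rfl, by omega, ?_⟩
    have : visitCount f (A ∩ Z M) 1 y = 0 := by simp [visitCount, hy]
    rw [this]
    positivity

/-- The set of the points whose frequency of visits to `A` has lower limit `0`. -/
def rareVisits {α : Type*} (f : α → α) (A : Set α) : Set α :=
  {y | ∀ j a : ℕ, ∃ N, a ≤ N ∧ visitCount f A N y ≤ 1 / ((j : ℝ) + 1) * N}

lemma preimage_rareVisits {α : Type*} (f : α → α) (A : Set α) :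
    f ⁻¹' rareVisits f A = rareVisits f A := by
  have hstep : ∀ N y, visitCount f A (N + 1) y =
      visitCount f A 1 y + visitCount f A N (f y) := fun N y => by
    rw [add_comm N 1, visitCount_add]; rfl
  ext y
  constructor
  · intro h j a
    obtain ⟨N, hN, hc⟩ := h (2 * j + 1) (max a (2 * j + 2))
    refine ⟨N + 1, by omega, ?_⟩
    have h1 : visitCount f A 1 y ≤ 1 := by exact_mod_cast visitCount_le (f := f) (A := A) 1 y
    have hN' : (2 * j + 2 : ℝ) ≤ N := by exact_mod_cast (le_max_right _ _).trans hN
    rw [hstep]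
    refine (add_le_add h1 hc).trans ?_
    push_cast
    rw [show (2 * (j : ℝ) + 1 + 1) = 2 * (j + 1) by ring, div_mul_eq_mul_div, div_mul_eq_mul_div,
      ← sub_nonneg]
    have : (1 * ((N : ℝ) + 1)) / (j + 1) - (1 + 1 * N / (2 * (j + 1))) =
        (N + 2 - 2 * (j + 1)) / (2 * (j + 1)) := by field_simp; ring
    rw [this]
    apply div_nonneg <;> nlinarith
  · intro h j a
    obtain ⟨N, hN, hc⟩ := h (2 * j + 1) (a + 2)
    obtain ⟨N, rfl⟩ := Nat.exists_eq_add_of_le' (show 1 ≤ N by omega)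
    refine ⟨N, by omega, ?_⟩
    rw [hstep] at hc
    have h1 : 0 ≤ visitCount f A 1 y := visitCount_nonneg 1 y
    have hN' : (1 : ℝ) ≤ N := by exact_mod_cast (by omega : 1 ≤ N)
    refine (le_add_of_nonneg_left h1).trans (hc.trans ?_)
    push_cast
    rw [show (2 * (j : ℝ) + 1 + 1) = 2 * (j + 1) by ring, div_mul_eq_mul_div, div_mul_eq_mul_div,
      ← sub_nonneg]
    have : 1 * (N : ℝ) / (j + 1) - 1 * (N + 1) / (2 * (j + 1)) =
        (N - 1) / (2 * (j + 1)) := by field_simp; ring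
    rw [this]
    apply div_nonneg <;> nlinarith

lemma measurableSet_rareVisits (hf : Measurable f) (hA : MeasurableSet A) :
    MeasurableSet (rareVisits f A) := by
  have : rareVisits f A = ⋂ j : ℕ, ⋂ a : ℕ, ⋃ N : ℕ, ⋃ _ : a ≤ N,
      {y | visitCount f A N y ≤ 1 / ((j : ℝ) + 1) * N} := by
    ext y; simp [rareVisits]
  rw [this]
  exact MeasurableSet.iInter fun j => MeasurableSet.iInter fun a => MeasurableSet.iUnion fun N =>
    MeasurableSet.iUnion fun _ =>
      measurableSet_le (measurable_visitCount hf hA N) measurable_const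

lemma lowerDensity_pos_of_notMem_rareVisits {α : Type*} {f : α → α} {A : Set α} {y : α}
    (hy : y ∉ rareVisits f A) : 0 < lowerDensity {n : ℕ | f^[n] y ∈ A} := by
  simp only [rareVisits, Set.mem_ofPred_eq, not_forall, not_exists, not_and, not_le] at hy
  obtain ⟨j, a, h⟩ := hy
  have hj : (0 : ℝ) < 1 / ((j : ℝ) + 1) := by positivity
  refine hj.trans_le (le_liminf_of_le ?_ ?_)
  · refine IsBoundedUnder.isCoboundedUnder_ge ⟨1, ?_⟩
    simp only [eventually_map]
    refine Eventually.of_forall fun N => ?_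
    rw [ncard_visits]
    exact div_le_one_of_le₀ (by exact_mod_cast visitCount_le (f := f) (A := A) (N + 1) y)
      (by positivity)
  · filter_upwards [eventually_ge_atTop a] with N hN
    rw [ncard_visits, le_div_iff₀ (by positivity)]
    exact_mod_cast (h (N + 1) (by omega)).le

/-- Under a strongly mixing transformation almost every orbit visits a given set of positive measure
along a set of times of positive lower density: the points which do not form an invariant set, so
that if it were not null it would have full measure, against the bound of
`measureReal_inter_visitCount_le`. -/
lemma IsStronglyMixing.ae_lowerDensity_pos [IsProbabilityMeasure μ] (hf : IsStronglyMixing f μ)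
    (hA : MeasurableSet A) (hpos : μ A ≠ 0) :
    ∀ᵐ y ∂μ, 0 < lowerDensity {n : ℕ | f^[n] y ∈ A} := by
  obtain ⟨hmp, hmix⟩ := hf
  set Z := rareVisits f A
  have hZ : MeasurableSet Z := measurableSet_rareVisits hmp.measurable hA
  have hinv : ∀ n, f^[n] ⁻¹' Z = Z := fun n => by
    induction n with
    | zero => rfl
    | succ n ih => rw [Function.iterate_succ, Set.preimage_comp, ih, preimage_rareVisits]
  have hsq : μ Z = μ Z * μ Z := by
    have := hmix Z Z hZ hZ
    simp only [hinv, Set.inter_self] at this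
    exact tendsto_nhds_unique tendsto_const_nhds this
  have hAZ : μ (A ∩ Z) = 0 := by
    rw [← measureReal_eq_zero_iff]
    refine le_antisymm (le_of_forall_pos_le_add fun ε hε => ?_) measureReal_nonneg
    obtain ⟨j, hj⟩ := exists_nat_one_div_lt hε
    rw [zero_add]
    refine le_trans ?_ ((measureReal_inter_visitCount_le hmp hA
      (show (0 : ℝ) ≤ 1 / ((j : ℝ) + 1) by positivity)).trans hj.le)
    refine measureReal_mono fun y hy => ⟨hy.1, ?_⟩
    obtain ⟨N, h1, h2⟩ := hy.2 j 1
    exact ⟨N, h1, h2⟩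
  have hZ0 : μ Z = 0 := by
    by_contra h0
    have h1 : μ Z = 1 := by
      have := (ENNReal.mul_right_inj h0 (measure_ne_top μ Z)).1 ((mul_one _).trans hsq)
      exact this.symm
    have : μ A ≤ μ (A ∩ Z) + μ Zᶜ := by
      refine (measure_mono fun y hy => ?_).trans (measure_union_le _ _)
      by_cases hyZ : y ∈ Z
      · exact Or.inl ⟨hy, hyZ⟩
      · exact Or.inr hyZ
    rw [hAZ, (prob_compl_eq_zero_iff hZ).2 h1, add_zero] at this
    exact hpos (nonpos_iff_eq_zero.1 this)
  filter_upwards [measure_eq_zero_iff_ae_notMem.1 hZ0] with y hy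
  exact lowerDensity_pos_of_notMem_rareVisits hy

end Measure

/-! ### Strong mixing of Bernoulli shifts and their factors -/

lemma hasSum_measureReal_iUnion {α : Type*} [MeasurableSpace α] {μ : Measure α}
    [IsFiniteMeasure μ] {B : ℕ → Set α} (hd : Pairwise (Function.onFun Disjoint B))
    (hB : ∀ i, MeasurableSet (B i)) : HasSum (fun i => μ.real (B i)) (μ.real (⋃ i, B i)) := by
  have h := measure_iUnion (μ := μ) hd hB
  have hne : ∑' i, μ (B i) ≠ ⊤ := h ▸ measure_ne_top _ _
  have := ENNReal.hasSum_toReal hne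
  rwa [← ENNReal.tsum_toReal_eq (fun i => measure_ne_top μ _), ← h] at this

/-- It suffices to test strong mixing on a `π`-system that generates the σ-algebra: with either of
the two sets fixed, the sets satisfying the limit relation form a Dynkin system, by dominated
convergence of the series over a disjoint union. -/
lemma isStronglyMixing_of_isPiSystem {α : Type*} [m : MeasurableSpace α] {f : α → α}
    {μ : Measure α} [IsProbabilityMeasure μ] (hf : MeasurePreserving f μ μ) {C : Set (Set α)}
    (hgen : m = MeasurableSpace.generateFrom C) (hC : IsPiSystem C)
    (h : ∀ A ∈ C, ∀ B ∈ C, Tendsto (fun n : ℕ => μ (A ∩ f^[n] ⁻¹' B)) atTop (𝓝 (μ A * μ B))) :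
    IsStronglyMixing f μ := by
  refine ⟨hf, ?_⟩
  have hreal : ∀ A B : Set α,
      Tendsto (fun n : ℕ => μ (A ∩ f^[n] ⁻¹' B)) atTop (𝓝 (μ A * μ B)) ↔
      Tendsto (fun n : ℕ => μ.real (A ∩ f^[n] ⁻¹' B)) atTop (𝓝 (μ.real A * μ.real B)) := by
    intro A B
    rw [measureReal_def μ A, measureReal_def μ B, ← ENNReal.toReal_mul]
    exact (ENNReal.tendsto_toReal_iff (fun n => measure_ne_top _ _)
      (ENNReal.mul_ne_top (measure_ne_top _ _) (measure_ne_top _ _))).symm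
  have hmC : ∀ A ∈ C, MeasurableSet A := fun A hA => by
    rw [hgen]; exact MeasurableSpace.measurableSet_generateFrom hA
  have hpre : ∀ {B}, MeasurableSet B → ∀ n, MeasurableSet (f^[n] ⁻¹' B) :=
    fun hB n => (hf.iterate n).measurable hB
  have hmeas : ∀ {B}, MeasurableSet B → ∀ n, μ.real (f^[n] ⁻¹' B) = μ.real B := fun hB n => by
    rw [measureReal_def, (hf.iterate n).measure_preimage hB.nullMeasurableSet, measureReal_def]
  simp only [hreal] at h ⊢
  have h1 : ∀ A ∈ C, ∀ B, MeasurableSet B →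
      Tendsto (fun n : ℕ => μ.real (A ∩ f^[n] ⁻¹' B)) atTop (𝓝 (μ.real A * μ.real B)) := by
    intro A hA
    refine MeasurableSpace.induction_on_inter hgen hC ?_ (h A hA) ?_ ?_
    · simp
    · intro B hB ih
      have e : ∀ n, μ.real (A ∩ f^[n] ⁻¹' Bᶜ) = μ.real A - μ.real (A ∩ f^[n] ⁻¹' B) := fun n => by
        rw [eq_sub_iff_add_eq, add_comm, Set.preimage_compl]
        exact measureReal_inter_add_sdiff (hpre hB n)
      simp only [e]
      rw [probReal_compl_eq_one_sub hB, mul_sub, mul_one]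
      exact tendsto_const_nhds.sub ih
    · intro B hd hB ih
      have e : ∀ n, μ.real (A ∩ f^[n] ⁻¹' ⋃ i, B i) = ∑' i, μ.real (A ∩ f^[n] ⁻¹' B i) :=
          fun n => by
        rw [Set.preimage_iUnion, Set.inter_iUnion]
        refine (hasSum_measureReal_iUnion (fun i j hij => ?_) fun i =>
          (hmC A hA).inter (hpre (hB i) n)).tsum_eq.symm
        exact ((hd hij).preimage _).mono Set.inter_subset_right Set.inter_subset_right
      have hsum := hasSum_measureReal_iUnion (μ := μ) hd hB
      simp only [e]
      rw [← hsum.tsum_eq, ← tsum_mul_left]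
      refine tendsto_tsum_of_dominated_convergence hsum.summable ih
        (Eventually.of_forall fun n i => ?_)
      rw [Real.norm_of_nonneg measureReal_nonneg, ← hmeas (hB i) n]
      exact measureReal_mono Set.inter_subset_right
  intro A B hA hB
  refine MeasurableSpace.induction_on_inter
    (C := fun A _ => Tendsto (fun n : ℕ => μ.real (A ∩ f^[n] ⁻¹' B)) atTop
      (𝓝 (μ.real A * μ.real B))) hgen hC ?_ (fun A hA => h1 A hA B hB) ?_ ?_ A hA
  · simp
  · intro A hA ih
    have e : ∀ n, μ.real (Aᶜ ∩ f^[n] ⁻¹' B) = μ.real B - μ.real (A ∩ f^[n] ⁻¹' B) := fun n => by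
      rw [eq_sub_iff_add_eq, add_comm, ← hmeas hB n, Set.inter_comm A, Set.inter_comm Aᶜ]
      exact measureReal_inter_add_sdiff hA
    simp only [e]
    rw [probReal_compl_eq_one_sub hA, sub_mul, one_mul]
    exact tendsto_const_nhds.sub ih
  · intro A hd hA ih
    have e : ∀ n, μ.real ((⋃ i, A i) ∩ f^[n] ⁻¹' B) = ∑' i, μ.real (A i ∩ f^[n] ⁻¹' B) :=
        fun n => by
      rw [Set.iUnion_inter]
      refine (hasSum_measureReal_iUnion (fun i j hij => ?_) fun i =>
        (hA i).inter (hpre hB n)).tsum_eq.symm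
      exact (hd hij).mono Set.inter_subset_left Set.inter_subset_left
    have hsum := hasSum_measureReal_iUnion (μ := μ) hd hA
    simp only [e]
    rw [← hsum.tsum_eq, ← tsum_mul_right]
    refine tendsto_tsum_of_dominated_convergence hsum.summable ih
      (Eventually.of_forall fun n i => ?_)
    rw [Real.norm_of_nonneg measureReal_nonneg]
    exact measureReal_mono Set.inter_subset_left

/-- The shift `(ξₙ) ↦ (ξₙ₋₁)` of bilateral sequences. -/
def bilateralShift (α : Type*) (ξ : ℤ → α) : ℤ → α := fun n => ξ (n - 1)

lemma bilateralShift_iterate {α : Type*} (n : ℕ) (ξ : ℤ → α) (i : ℤ) :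
    (bilateralShift α)^[n] ξ i = ξ (i - n) := by
  induction n generalizing i with
  | zero => simp
  | succ n ih =>
    rw [Function.iterate_succ_apply']
    simp only [bilateralShift, ih]
    congr 1
    push_cast
    ring

section Bernoulli

variable {α : Type*} [MeasurableSpace α] (ν : Measure α) [IsProbabilityMeasure ν]

lemma measurePreserving_bilateralShift :
    MeasurePreserving (bilateralShift α) (Measure.infinitePi fun _ : ℤ => ν)
      (Measure.infinitePi fun _ : ℤ => ν) :=
  ⟨measurable_pi_iff.2 fun _ => measurable_pi_apply _,
    Measure.map_infinitePi_infinitePi_of_inj (P := fun _ : ℤ => ν) (f := fun n : ℤ => n - 1)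
      fun a b h => by simpa using h⟩

/-- The boxes with finitely many constrained coordinates form a generating `π`-system, and two of
them become independent once the shift has made their sets of coordinates disjoint. -/
lemma isStronglyMixing_bilateralShift :
    IsStronglyMixing (bilateralShift α) (Measure.infinitePi fun _ : ℤ => ν) := by
  classical
  refine isStronglyMixing_of_isPiSystem (measurePreserving_bilateralShift ν)
    (generateFrom_squareCylinders (α := fun _ : ℤ => α)).symm
    (isPiSystem_squareCylinders (fun _ => MeasurableSpace.isPiSystem_measurableSet)
      fun _ => MeasurableSet.univ) ?_
  rintro _ ⟨I, (s : ℤ → Set α), hs, rfl⟩ _ ⟨J, (t : ℤ → Set α), ht, rfl⟩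
  have hs' : ∀ i, MeasurableSet (s i) := fun i => hs i (Set.mem_univ _)
  have ht' : ∀ i, MeasurableSet (t i) := fun i => ht i (Set.mem_univ _)
  obtain ⟨a, ha⟩ := I.finite_toSet.bddBelow
  obtain ⟨b, hb⟩ := J.finite_toSet.bddAbove
  refine tendsto_const_nhds.congr' ?_
  filter_upwards [eventually_gt_atTop (b - a).toNat] with n hn
  have hn' : b - a < n := by omega
  set e : ℤ ↪ ℤ := (Equiv.subRight (n : ℤ)).toEmbedding with he
  have hpre : (bilateralShift α)^[n] ⁻¹' (J : Set ℤ).pi t =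
      ((J.map e : Finset ℤ) : Set ℤ).pi fun k => t (k + n) := by
    ext ξ
    simp [Set.mem_pi, bilateralShift_iterate, he]
  have hdisj : Disjoint I (J.map e) := by
    rw [Finset.disjoint_left]
    intro k hk hk'
    obtain ⟨j, hj, rfl⟩ := Finset.mem_map.1 hk'
    have h1 := ha hk
    have h2 := hb hj
    simp only [he, Equiv.coe_toEmbedding, Equiv.subRight_apply] at h1
    omega
  have hinter : (I : Set ℤ).pi s ∩ ((J.map e : Finset ℤ) : Set ℤ).pi (fun k => t (k + n)) =
      ((I ∪ J.map e : Finset ℤ) : Set ℤ).pi fun k => if k ∈ I then s k else t (k + n) := by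
    ext ξ
    simp only [Set.mem_inter_iff, Set.mem_pi, Finset.mem_coe, Finset.mem_union]
    constructor
    · rintro ⟨h1, h2⟩ k hk
      split_ifs with hkI
      · exact h1 k hkI
      · exact h2 k (hk.resolve_left hkI)
    · intro h
      refine ⟨fun k hk => by simpa [hk] using h k (Or.inl hk), fun k hk => ?_⟩
      simpa [Finset.disjoint_right.1 hdisj hk] using h k (Or.inr hk)
  rw [hpre, hinter, Measure.infinitePi_pi _ fun k _ => hs' k,
    Measure.infinitePi_pi _ fun k _ => ht' k,
    Measure.infinitePi_pi _ (fun k _ => ?_), Finset.prod_union hdisj]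
  · congr 1
    · exact Finset.prod_congr rfl fun k hk => by simp [hk]
    · rw [Finset.prod_map]
      refine Finset.prod_congr rfl fun k hk => ?_
      have := Finset.disjoint_right.1 hdisj (Finset.mem_map_of_mem e hk)
      simp [this]
      simp [he]
  · split_ifs
    exacts [hs' k, ht' _]

end Bernoulli

/-- A factor of a strongly mixing transformation is strongly mixing. -/
lemma IsStronglyMixing.factor {α β : Type*} [MeasurableSpace α] [MeasurableSpace β] {f : α → α}
    {g : β → β} {μ : Measure α} (hf : IsStronglyMixing f μ) (hg : Measurable g) {F : α → β}
    (hF : AEMeasurable F μ) (h : F ∘ f =ᵐ[μ] g ∘ F) : IsStronglyMixing g (μ.map F) := by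
  obtain ⟨hmp, hmix⟩ := hf
  have hit : ∀ n, F ∘ f^[n] =ᵐ[μ] g^[n] ∘ F := fun n => by
    induction n with
    | zero => rfl
    | succ n ih =>
      have h1 := (hmp.iterate n).quasiMeasurePreserving.ae_eq_comp h
      filter_upwards [h1, ih] with x h1 h2
      simp only [Function.comp_apply, Function.iterate_succ_apply'] at *
      rw [h1, h2]
  refine ⟨⟨hg, ?_⟩, fun A B hA hB => ?_⟩
  · rw [AEMeasurable.map_map_of_aemeasurable hg.aemeasurable hF, ← Measure.map_congr h,
      ← AEMeasurable.map_map_of_aemeasurable (by rwa [hmp.map_eq]) hmp.aemeasurable, hmp.map_eq]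
  · set F' := hF.mk F
    have hF' : Measurable F' := hF.measurable_mk
    have hae : F =ᵐ[μ] F' := hF.ae_eq_mk
    rw [Measure.map_congr hae, Measure.map_apply hF' hA, Measure.map_apply hF' hB]
    refine (hmix _ _ (hF' hA) (hF' hB)).congr fun n => ?_
    rw [Measure.map_apply hF' (hA.inter (hg.iterate n hB))]
    refine measure_congr ?_
    have h1 := (hmp.iterate n).quasiMeasurePreserving.ae_eq_comp hae
    filter_upwards [h1, hit n, hae] with x h1 h2 h3
    simp only [Function.comp_apply] at h1 h2
    refine propext (and_congr Iff.rfl ?_)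
    change F' (f^[n] x) ∈ B ↔ g^[n] (F' x) ∈ B
    rw [← h1, h2, h3]

/-! ### Bounded multipliers in locally convex and locally bounded spaces -/

section Multipliers

variable {𝕜 E : Type*} [RCLike 𝕜] [NormedAddCommGroup E] [Module 𝕜 E] [ContinuousSMul 𝕜 E]

lemma exists_norm_sum_smul_lt {ι : Type*} (t : Finset ι) (w : ι → E) {ρ : ℝ} (hρ : 0 < ρ) :
    ∃ δ > 0, ∀ c : ι → 𝕜, (∀ i ∈ t, ‖c i‖ ≤ δ) → ‖∑ i ∈ t, c i • w i‖ < ρ := by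
  classical
  induction t using Finset.induction_on generalizing ρ with
  | empty => exact ⟨1, one_pos, fun c _ => by simpa using hρ⟩
  | insert i t hi ih =>
    obtain ⟨δ, hδ, h⟩ := ih (half_pos hρ)
    have hc : Tendsto (fun a : 𝕜 => a • w i) (𝓝 0) (𝓝 0) := by
      have : Continuous fun a : 𝕜 => a • w i := by fun_prop
      simpa using this.tendsto 0
    obtain ⟨η, hη, h'⟩ := Metric.mem_nhds_iff.1 (hc (Metric.ball_mem_nhds 0 (half_pos hρ)))
    refine ⟨min δ (η / 2), by positivity, fun c hct => ?_⟩
    rw [Finset.sum_insert hi]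
    have h1 : ‖c i • w i‖ < ρ / 2 := by
      have : c i ∈ Metric.ball (0 : 𝕜) η := by
        rw [mem_ball_zero_iff]
        have := (hct i (Finset.mem_insert_self _ _)).trans (min_le_right _ _)
        linarith
      simpa using h' this
    have h2 := h c fun j hj => (hct j (Finset.mem_insert_of_mem hj)).trans (min_le_left _ _)
    calc _ ≤ ‖c i • w i‖ + ‖∑ j ∈ t, c j • w j‖ := norm_add_le _ _
      _ < ρ := by linarith

end Multipliers

section RealMultipliers

lemma Convex.add_sum_smul_mem {ι : Type*} {E : Type*} [AddCommGroup E] [Module ℝ E]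
    {W : Set E} (hW : Convex ℝ W) (t : Finset ι) (w : ι → E)
    (b : ι → ℝ) (hb : ∀ i, b i ∈ Set.Icc (0 : ℝ) 1) :
    ∀ x : E, (∀ s ⊆ t, x + ∑ i ∈ s, w i ∈ W) → x + ∑ i ∈ t, b i • w i ∈ W := by
  classical
  induction t using Finset.induction_on with
  | empty => intro x h; simpa using h ∅ le_rfl
  | insert i t hi ih =>
    intro x h
    rw [Finset.sum_insert hi, ← add_assoc]
    refine ih _ fun s hs => ?_
    have h1 := h s (hs.trans (Finset.subset_insert _ _))
    have h2 := h (insert i s) (Finset.insert_subset_insert _ hs)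
    rw [Finset.sum_insert fun h => hi (hs h)] at h2
    convert hW h1 h2 (sub_nonneg.2 (hb i).2) (hb i).1 (by ring) using 1
    module

variable {E : Type*} [NormedAddCommGroup E] [Module ℝ E]

lemma exists_nhds_sum_smul_mem_of_locallyConvex [LocallyConvexSpace ℝ E] {V : Set E}
    (hV : V ∈ 𝓝 (0 : E)) : ∃ W ∈ 𝓝 (0 : E), ∀ (t : Finset ℤ) (w : ℤ → E),
      (∀ s ⊆ t, ∑ i ∈ s, w i ∈ W) → ∀ b : ℤ → ℝ, (∀ i, b i ∈ Set.Icc (0 : ℝ) 1) →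
        ∑ i ∈ t, b i • w i ∈ V := by
  obtain ⟨W, ⟨hW0, hWc⟩, hWV⟩ := (LocallyConvexSpace.convex_basis_zero ℝ E).mem_iff.1 hV
  refine ⟨W, hW0, fun t w h b hb => hWV ?_⟩
  simpa using hWc.add_sum_smul_mem t w b hb 0 (by simpa using h)

variable [ContinuousSMul ℝ E]

/-- The argument is by digits in a base `N` adapted to the space: if `U + U ⊆ M • U` with `U`
bounded and balanced, then multiplying by `N = 2 M` and splitting off the integer parts of the
coefficients writes `N • ∑ bᵢ wᵢ` as a sum of `N` subset sums and of a sum of the same form; hence a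
bound `λ • U` for all the sums `∑ bᵢ wᵢ` improves to `(λ / 2) • U`, as long as `λ • U` absorbs the
digit part. -/
lemma exists_nhds_sum_smul_mem_of_isVonNBounded {U₀ : Set E} (hU₀ : U₀ ∈ 𝓝 (0 : E))
    (hb₀ : Bornology.IsVonNBounded ℝ U₀) {V : Set E}
    (hV : V ∈ 𝓝 (0 : E)) : ∃ W ∈ 𝓝 (0 : E), ∀ (t : Finset ℤ) (w : ℤ → E),
      (∀ s ⊆ t, ∑ i ∈ s, w i ∈ W) → ∀ b : ℤ → ℝ, (∀ i, b i ∈ Set.Icc (0 : ℝ) 1) →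
        ∑ i ∈ t, b i • w i ∈ V := by
  classical
  set U := balancedCore ℝ U₀ with hUdef
  have hU : U ∈ 𝓝 (0 : E) := balancedCore_mem_nhds_zero hU₀
  have hUb : Balanced ℝ U := balancedCore_balanced _
  have hbU : Bornology.IsVonNBounded ℝ U := hb₀.subset (balancedCore_subset _)
  obtain ⟨M, hM1, hM⟩ : ∃ M : ℕ, 1 ≤ M ∧ ∀ x ∈ U, ∀ y ∈ U, ∃ u ∈ U, x + y = (M : ℝ) • u := by
    obtain ⟨r, hr, h⟩ := ((hbU.add hbU) hU).exists_pos
    obtain ⟨M, hM⟩ := exists_nat_ge (max r 1)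
    refine ⟨M, by exact_mod_cast (le_max_right _ _).trans hM, fun x hx y hy => ?_⟩
    have := h (M : ℝ) (by simpa using (le_max_left _ _).trans hM) (Set.add_mem_add hx hy)
    obtain ⟨u, hu, h'⟩ := this
    exact ⟨u, hu, h'.symm⟩
  obtain ⟨ε, hε, hεV⟩ : ∃ ε : ℝ, 0 < ε ∧ ∀ u ∈ U, ε • u ∈ V := by
    obtain ⟨r, hr, h⟩ := (hbU hV).exists_pos
    refine ⟨r⁻¹, by positivity, fun u hu => ?_⟩
    obtain ⟨v, hv, rfl⟩ := h r (by simp [abs_of_pos hr]) hu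
    simpa [smul_smul, inv_mul_cancel₀ hr.ne'] using hv
  have hscale : ∀ {a a' : ℝ}, 0 ≤ a → a ≤ a' → 0 < a' → ∀ u ∈ U, ∃ u' ∈ U, a • u = a' • u' := by
    intro a a' h0 h1 h2 u hu
    refine ⟨(a / a') • u, hUb.smul_mem (by 
    rw [Real.norm_of_nonneg (by positivity)]
    exact (div_le_one h2).2 h1) hu, ?_⟩
    rw [smul_smul, mul_div_cancel₀ _ h2.ne']
  have hMpos : (0 : ℝ) < M := by exact_mod_cast hM1
  set N := 2 * M with hN
  have hNpos : (0 : ℝ) < N := by rw [hN]; push_cast; positivity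
  have hεU : ∀ᶠ x in 𝓝 (0 : E), ∃ u ∈ U, x = ε • u := by
    have hc : Tendsto (fun x : E => ε⁻¹ • x) (𝓝 0) (𝓝 0) := by
      simpa using (continuous_const_smul (ε⁻¹ : ℝ)).tendsto (0 : E)
    filter_upwards [hc hU] with x hx
    exact ⟨_, hx, by rw [smul_smul, mul_inv_cancel₀ hε.ne', one_smul]⟩
  obtain ⟨ρ, hρ, hρU⟩ := Metric.mem_nhds_iff.1 hεU
  refine ⟨Metric.ball 0 (ρ / (N + 1)), Metric.ball_mem_nhds _ (by positivity), ?_⟩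
  intro t w hw
  -- a first bound, uniform in the coefficients
  obtain ⟨n₀, hn₀⟩ : ∃ n₀ : ℕ, ∀ b : ℤ → ℝ, (∀ i, b i ∈ Set.Icc (0 : ℝ) 1) →
      ∃ u ∈ U, ∑ i ∈ t, b i • w i = (ε * 2 ^ n₀) • u := by
    obtain ⟨δ, hδ, h⟩ := exists_norm_sum_smul_lt (𝕜 := ℝ) t w hρ
    obtain ⟨n₀, hn₀⟩ := exists_pow_lt_of_lt_one hδ (show (1 / 2 : ℝ) < 1 by norm_num)
    refine ⟨n₀, fun b hb => ?_⟩
    have := h (fun i => (1 / 2) ^ n₀ * b i) fun i _ => by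
      rw [Real.norm_of_nonneg (mul_nonneg (by positivity) (hb i).1)]
      exact (mul_le_of_le_one_right (by positivity) (hb i).2).trans hn₀.le
    obtain ⟨u, hu, he⟩ := hρU (mem_ball_zero_iff.2 this)
    refine ⟨u, hu, ?_⟩
    simp only [mul_smul] at he
    rw [← Finset.smul_sum] at he
    rw [mul_comm, mul_smul, ← he, smul_smul, ← mul_pow]
    norm_num
  -- each step divides the bound by two
  have hstep : ∀ m : ℕ, (∀ b : ℤ → ℝ, (∀ i, b i ∈ Set.Icc (0 : ℝ) 1) →
      ∃ u ∈ U, ∑ i ∈ t, b i • w i = (ε * 2 ^ (m + 1)) • u) → ∀ b : ℤ → ℝ,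
      (∀ i, b i ∈ Set.Icc (0 : ℝ) 1) → ∃ u ∈ U, ∑ i ∈ t, b i • w i = (ε * 2 ^ m) • u := by
    intro m hm b hb
    set d : ℤ → ℕ := fun i => ⌊N * b i⌋₊ with hd
    have hNb : ∀ i, 0 ≤ N * b i := fun i => mul_nonneg hNpos.le (hb i).1
    have hdN : ∀ i, d i ≤ N := fun i => by
      have : (d i : ℝ) ≤ N := (Nat.floor_le (hNb i)).trans
        (mul_le_of_le_one_right hNpos.le (hb i).2)
      exact_mod_cast this
    obtain ⟨u₁, hu₁, h₁⟩ := hm (fun i => N * b i - d i) fun i =>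
      ⟨sub_nonneg.2 (Nat.floor_le (hNb i)), by
        have := (Nat.lt_floor_add_one ((N : ℝ) * b i)).le
        simp only [hd]; linarith⟩
    have hdigit : ∑ i ∈ t, (d i : ℝ) • w i = ∑ j ∈ Finset.range N, ∑ i ∈ t with j < d i, w i := by
      simp only [Finset.sum_filter]
      rw [Finset.sum_comm]
      refine Finset.sum_congr rfl fun i _ => ?_
      rw [← Finset.sum_filter, Finset.sum_const, Nat.cast_smul_eq_nsmul]
      congr 1
      have : (Finset.range N).filter (fun j => j < d i) = Finset.range (d i) := by
        ext j
        simp only [Finset.mem_filter, Finset.mem_range]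
        have := hdN i
        omega
      rw [this, Finset.card_range]
    obtain ⟨u₂, hu₂, h₂⟩ : ∃ u ∈ U, ∑ i ∈ t, (d i : ℝ) • w i = ε • u := by
      refine hρU (mem_ball_zero_iff.2 ?_)
      rw [hdigit]
      calc _ ≤ ∑ j ∈ Finset.range N, ‖∑ i ∈ t with j < d i, w i‖ := norm_sum_le _ _
        _ ≤ ∑ j ∈ Finset.range N, ρ / (N + 1) := Finset.sum_le_sum fun j _ =>
          (mem_ball_zero_iff.1 (hw _ (Finset.filter_subset _ _))).le
        _ = N * (ρ / (N + 1)) := by simp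
        _ < ρ := by
          rw [mul_div_assoc', div_lt_iff₀ (by positivity)]
          nlinarith
    obtain ⟨u₃, hu₃, h₃⟩ := hscale hε.le (le_mul_of_one_le_right hε.le
      (one_le_pow₀ (show (1 : ℝ) ≤ 2 by norm_num) : (1 : ℝ) ≤ 2 ^ (m + 1))) (by positivity) u₂ hu₂
    obtain ⟨u, hu, h⟩ := hM u₁ hu₁ u₃ hu₃
    refine ⟨u, hu, ?_⟩
    have hsum : (N : ℝ) • ∑ i ∈ t, b i • w i = (ε * 2 ^ (m + 1)) • ((M : ℝ) • u) := by
      rw [← h, smul_add, ← h₁, ← h₃, ← h₂, ← Finset.sum_add_distrib, Finset.smul_sum]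
      exact Finset.sum_congr rfl fun i _ => by module
    have : ∑ i ∈ t, b i • w i = (N : ℝ)⁻¹ • ((N : ℝ) • ∑ i ∈ t, b i • w i) := by
      rw [smul_smul, inv_mul_cancel₀ hNpos.ne', one_smul]
    rw [this, hsum, smul_smul, smul_smul]
    congr 1
    rw [hN]
    push_cast
    field_simp
    ring
  have hall : ∀ m, (∀ b : ℤ → ℝ, (∀ i, b i ∈ Set.Icc (0 : ℝ) 1) →
      ∃ u ∈ U, ∑ i ∈ t, b i • w i = (ε * 2 ^ m) • u) → ∀ b : ℤ → ℝ,
      (∀ i, b i ∈ Set.Icc (0 : ℝ) 1) → ∃ u ∈ U, ∑ i ∈ t, b i • w i = ε • u := by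
    intro m
    induction m with
    | zero => simp
    | succ m ih => exact fun h => ih (hstep m h)
  intro b hb
  obtain ⟨u, hu, h⟩ := hall n₀ hn₀ b hb
  rw [h]
  exact hεV u hu

end RealMultipliers

section Multipliers

variable {𝕜 E : Type*} [RCLike 𝕜] [NormedAddCommGroup E] [Module 𝕜 E] [ContinuousSMul 𝕜 E]

/-- In a locally bounded or locally convex space, a finite family with small subset sums has small
combinations with coefficients in the unit ball of the scalar field. This is the only place where
the assumption on the space enters. -/
lemma exists_norm_sum_smul_lt_of_subset_sums [Module ℝ E] [IsScalarTower ℝ 𝕜 E]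
    (hE : IsLocallyBoundedTVS 𝕜 E ∨ LocallyConvexSpace ℝ E) {ε : ℝ} (hε : 0 < ε) :
    ∃ δ > 0, ∀ (t : Finset ℤ) (w : ℤ → E), (∀ s ⊆ t, ‖∑ i ∈ s, w i‖ < δ) →
      ∀ b : ℤ → 𝕜, (∀ i, ‖b i‖ ≤ 1) → ‖∑ i ∈ t, b i • w i‖ < ε := by
  have : ContinuousSMul ℝ E := IsScalarTower.continuousSMul 𝕜
  have hI : ∀ᶠ x : E in 𝓝 0, ‖(RCLike.I : 𝕜) • x‖ < ε / 4 := by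
    have hc : Tendsto (fun x : E => ‖(RCLike.I : 𝕜) • x‖) (𝓝 0) (𝓝 0) := by
      have : Continuous fun x : E => ‖(RCLike.I : 𝕜) • x‖ := by fun_prop
      simpa using this.tendsto 0
    exact hc.eventually (gt_mem_nhds (by positivity))
  have h1 : ∀ᶠ x : E in 𝓝 0, ‖x‖ < ε / 4 := by
    filter_upwards [Metric.ball_mem_nhds (0 : E) (show 0 < ε / 4 by positivity)] with x hx
    simpa using hx
  obtain ⟨W, hW, hWV⟩ : ∃ W ∈ 𝓝 (0 : E), ∀ (t : Finset ℤ) (w : ℤ → E),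
      (∀ s ⊆ t, ∑ i ∈ s, w i ∈ W) → ∀ b : ℤ → ℝ, (∀ i, b i ∈ Set.Icc (0 : ℝ) 1) →
        ∑ i ∈ t, b i • w i ∈ {x : E | ‖(RCLike.I : 𝕜) • x‖ < ε / 4 ∧ ‖x‖ < ε / 4} := by
    rcases hE with ⟨U, hU, hUb⟩ | hE
    · exact exists_nhds_sum_smul_mem_of_isVonNBounded hU (hUb.restrict_scalars ℝ) (hI.and h1)
    · exact exists_nhds_sum_smul_mem_of_locallyConvex (hI.and h1)
  obtain ⟨δ, hδ, hδW⟩ := Metric.mem_nhds_iff.1 hW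
  refine ⟨δ, hδ, fun t w hw b hb => ?_⟩
  have key := hWV t w fun s hs => hδW (mem_ball_zero_iff.2 (hw s hs))
  have hpart : ∀ r : ℤ → ℝ, (∀ i, |r i| ≤ 1) → ∀ i, max (r i) 0 ∈ Set.Icc (0 : ℝ) 1 := fun r hr i =>
    ⟨le_max_right _ _, max_le ((le_abs_self _).trans (hr i)) zero_le_one⟩
  have hre : ∀ i, |RCLike.re (b i)| ≤ 1 := fun i => (RCLike.abs_re_le_norm _).trans (hb i)
  have him : ∀ i, |RCLike.im (b i)| ≤ 1 := fun i => (RCLike.abs_im_le_norm _).trans (hb i)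
  have k1 := key _ (hpart (fun i => RCLike.re (b i)) hre)
  have k2 := key _ (hpart (fun i => -RCLike.re (b i)) (by simpa using hre))
  have k3 := key _ (hpart (fun i => RCLike.im (b i)) him)
  have k4 := key _ (hpart (fun i => -RCLike.im (b i)) (by simpa using him))
  have hmax : ∀ r : ℝ, max r 0 - max (-r) 0 = r := fun r => by
    rcases le_total r 0 with h | h <;> simp [h]
  have hcoe : ∀ (r : ℝ) (x : E), (r : 𝕜) • x = r • x := fun r x => by
    rw [← RCLike.algebraMap_eq_ofReal, algebraMap_smul]
  have hsplit : ∑ i ∈ t, b i • w i =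
      (∑ i ∈ t, max (RCLike.re (b i)) 0 • w i - ∑ i ∈ t, max (-RCLike.re (b i)) 0 • w i) +
      ((RCLike.I : 𝕜) • ∑ i ∈ t, max (RCLike.im (b i)) 0 • w i -
        (RCLike.I : 𝕜) • ∑ i ∈ t, max (-RCLike.im (b i)) 0 • w i) := by
    rw [← smul_sub, ← Finset.sum_sub_distrib, ← Finset.sum_sub_distrib, Finset.smul_sum,
      ← Finset.sum_add_distrib]
    refine Finset.sum_congr rfl fun i _ => ?_
    rw [← sub_smul, ← sub_smul, hmax, hmax, ← hcoe, ← hcoe, smul_smul, ← add_smul, mul_comm,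
      RCLike.re_add_im]
  rw [hsplit]
  refine (norm_add_le _ _).trans_lt ((add_le_add (norm_sub_le _ _) (norm_sub_le _ _)).trans_lt ?_)
  linarith [k1.2, k2.2, k3.1, k4.1]

end Multipliers

/-! ### Multiplier summable families -/

/-- A family of vectors indexed by `ℤ` is multiplier summable if its finite partial sums taken far
away, with arbitrary coefficients from the unit ball of `𝕜`, are uniformly small. -/
def IsMultiplierSummable (𝕜 : Type*) {E : Type*} [RCLike 𝕜] [NormedAddCommGroup E] [Module 𝕜 E]
    (z : ℤ → E) : Prop :=
  ∀ ε > 0, ∃ s : Finset ℤ, ∀ t : Finset ℤ, Disjoint t s → ∀ b : ℤ → 𝕜, (∀ i, ‖b i‖ ≤ 1) →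
    ‖∑ i ∈ t, b i • z i‖ < ε

section MultiplierSummable

variable {𝕜 E : Type*} [RCLike 𝕜] [NormedAddCommGroup E] [Module 𝕜 E]

lemma Summable.isMultiplierSummable [ContinuousSMul 𝕜 E] [CompleteSpace E] [Module ℝ E]
    [IsScalarTower ℝ 𝕜 E] (hE : IsLocallyBoundedTVS 𝕜 E ∨ LocallyConvexSpace ℝ E) {z : ℤ → E}
    (hz : Summable z) : IsMultiplierSummable 𝕜 z := by
  intro ε hε
  obtain ⟨δ, hδ, h⟩ := exists_norm_sum_smul_lt_of_subset_sums (𝕜 := 𝕜) hE hε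
  obtain ⟨s, hs⟩ := summable_iff_vanishing_norm.1 hz δ hδ
  exact ⟨s, fun t ht b hb => h t z (fun r hr => hs r (ht.mono_left hr)) b hb⟩

namespace IsMultiplierSummable

variable {z : ℤ → E}

lemma comp_equiv (hz : IsMultiplierSummable 𝕜 z) (e : ℤ ≃ ℤ) :
    IsMultiplierSummable 𝕜 fun n => z (e n) := by
  intro ε hε
  obtain ⟨s, hs⟩ := hz ε hε
  refine ⟨s.map e.symm.toEmbedding, fun t ht b hb => ?_⟩
  have := hs (t.map e.toEmbedding) (by
    rw [Finset.disjoint_left] at ht ⊢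
    intro i hi hi'
    obtain ⟨j, hj, rfl⟩ := Finset.mem_map.1 hi
    exact ht hj (Finset.mem_map.2 ⟨_, hi', by simp⟩)) (fun i => b (e.symm i)) fun i => hb _
  simpa using this

lemma summable_smul [CompleteSpace E] (hz : IsMultiplierSummable 𝕜 z) {b : ℤ → 𝕜}
    (hb : {i | ¬ ‖b i‖ ≤ 1}.Finite) : Summable fun i => b i • z i := by
  classical
  rw [summable_iff_vanishing_norm]
  intro ε hε
  obtain ⟨s, hs⟩ := hz ε hε
  refine ⟨s ∪ hb.toFinset, fun t ht => ?_⟩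
  have h := hs t (ht.mono_right Finset.subset_union_left) (fun i => if ‖b i‖ ≤ 1 then b i else 0)
    fun i => by split_ifs with h <;> simp [h]
  rwa [Finset.sum_congr rfl fun i hi => ?_] at h
  have : ‖b i‖ ≤ 1 := by
    by_contra hbi
    exact Finset.disjoint_left.1 ht hi (Finset.mem_union_right _ (by simpa using hbi))
  simp [this]

lemma tendsto_cofinite (hz : IsMultiplierSummable 𝕜 z) : Tendsto z cofinite (𝓝 0) := by
  rw [Metric.tendsto_nhds]
  intro ε hε
  obtain ⟨s, hs⟩ := hz ε hε
  filter_upwards [s.finite_toSet.compl_mem_cofinite] with i hi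
  simpa using hs {i} (by simpa using hi) (fun _ => 1) (by simp)

/-- The combinations of a multiplier summable family with coefficients in the unit ball form a
bounded set. -/
lemma exists_norm_sum_mul_smul_lt [ContinuousSMul 𝕜 E] (hz : IsMultiplierSummable 𝕜 z) {ε : ℝ}
    (hε : 0 < ε) : ∃ δ > 0, ∀ c : 𝕜, ‖c‖ ≤ δ → ∀ (t : Finset ℤ) (b : ℤ → 𝕜), (∀ i, ‖b i‖ ≤ 1) →
      ‖∑ i ∈ t, (c * b i) • z i‖ < ε := by
  classical
  obtain ⟨s, hs⟩ := hz (ε / 2) (half_pos hε)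
  obtain ⟨δ, hδ, h⟩ := exists_norm_sum_smul_lt (𝕜 := 𝕜) s z (half_pos hε)
  refine ⟨min δ 1, by positivity, fun c hc t b hb => ?_⟩
  have hcb : ∀ i, ‖c * b i‖ ≤ min δ 1 := fun i => by
    rw [norm_mul]
    exact (mul_le_of_le_one_right (norm_nonneg _) (hb i)).trans hc
  have h1 := hs (t \ s) Finset.sdiff_disjoint (fun i => c * b i)
    fun i => (hcb i).trans (min_le_right _ _)
  have h2 := h (fun i => if i ∈ t then c * b i else 0) fun i _ => by
    split_ifs
    · exact (hcb i).trans (min_le_left _ _)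
    · simpa using hδ.le
  have h3 : ∑ i ∈ s, (if i ∈ t then c * b i else 0) • z i = ∑ i ∈ t ∩ s, (c * b i) • z i := by
    simp only [ite_smul, zero_smul]
    rw [← Finset.sum_filter, Finset.filter_mem_eq_inter, Finset.inter_comm]
  rw [h3] at h2
  rw [← Finset.sum_inter_add_sum_sdiff t s]
  exact (norm_add_le _ _).trans_lt (by linarith)

/-- A multiplier summable family stays so when it is multiplied by suitable weights that tend to
infinity: along finite sets `s 0 ⊆ s 1 ⊆ …` beyond which the sums are geometrically small, the
weight of `i` is one plus the number of the `k` with `i ∉ s k`. -/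
lemma exists_weights (hz : IsMultiplierSummable 𝕜 z) :
    ∃ a : ℤ → ℝ, (∀ i, 1 ≤ a i) ∧ Tendsto a cofinite atTop ∧
      IsMultiplierSummable 𝕜 fun i => (a i : 𝕜) • z i := by
  classical
  choose s₀ hs₀ using fun k : ℕ => hz ((1 / 4) ^ k) (by positivity)
  set s : ℕ → Finset ℤ := fun k =>
    (Finset.range (k + 1)).biUnion s₀ ∪ Finset.Icc (-(k : ℤ)) k with hs
  have hmono : Monotone s := fun k l hkl => Finset.union_subset_union
    (Finset.biUnion_subset_biUnion_of_subset_left _ (by simpa using hkl))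
    (Finset.Icc_subset_Icc (by omega) (by omega))
  have hsum : ∀ k t, Disjoint t (s k) → ∀ b : ℤ → 𝕜, (∀ i, ‖b i‖ ≤ 1) →
      ‖∑ i ∈ t, b i • z i‖ < (1 / 4) ^ k := fun k t ht b hb =>
    hs₀ k t (ht.mono_right ((Finset.subset_biUnion_of_mem s₀ (by simp)).trans
      Finset.subset_union_left)) b hb
  have hmem : ∀ i : ℤ, ∀ k : ℕ, i.natAbs ≤ k → i ∈ s k := fun i k hk =>
    Finset.mem_union_right _ (Finset.mem_Icc.2 (by omega))
  -- the number of the `k` with `i ∉ s k`, all of which are less than `|i|`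
  set r : ℤ → ℕ := fun i => ((Finset.range i.natAbs).filter fun k => i ∉ s k).card with hr
  have hr' : ∀ (K : ℕ) (i : ℤ), i.natAbs ≤ K →
      r i = ∑ k ∈ Finset.range K, if i ∉ s k then 1 else 0 := fun K i hK => by
    rw [← Finset.card_filter]
    refine congrArg Finset.card (Finset.ext fun k => ?_)
    simp only [Finset.mem_filter, Finset.mem_range]
    refine and_congr_left fun hk => ⟨fun h => h.trans_le hK, fun _ => ?_⟩
    by_contra! h
    exact hk (hmem i k h)
  refine ⟨fun i => 1 + r i, fun i => by simp, ?_, ?_⟩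
  · refine tendsto_atTop_add_const_left _ _ (tendsto_natCast_atTop_atTop.comp ?_)
    rw [tendsto_atTop]
    intro K
    filter_upwards [(s K).finite_toSet.compl_mem_cofinite] with i hi
    have hiK : K ≤ i.natAbs := by
      by_contra! h
      exact hi (hmem i K h.le)
    calc K = (Finset.range K).card := by simp
      _ ≤ _ := Finset.card_le_card fun k hk => by
        rw [Finset.mem_range] at hk
        simp only [Finset.mem_filter, Finset.mem_range]
        exact ⟨by omega, fun h => hi (hmono hk.le h)⟩
  · intro ε hε
    obtain ⟨K, hK⟩ : ∃ K : ℕ, (1 / 2 : ℝ) ^ K * 3 < ε := by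
      obtain ⟨K, hK⟩ := exists_pow_lt_of_lt_one (show 0 < ε / 3 by positivity)
        (show (1 / 2 : ℝ) < 1 by norm_num)
      exact ⟨K, by linarith⟩
    refine ⟨s K, fun t ht b hb => lt_of_le_of_lt ?_ hK⟩
    set L := t.sup Int.natAbs with hL
    have hexp : ∑ i ∈ t, b i • ((((1 + r i : ℝ) : ℝ) : 𝕜) • z i) = ∑ i ∈ t, b i • z i +
        ∑ k ∈ Finset.range L, ∑ i ∈ t with i ∉ s k, b i • z i := by
      simp only [Finset.sum_filter]
      rw [Finset.sum_comm, ← Finset.sum_add_distrib]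
      refine Finset.sum_congr rfl fun i hi => ?_
      rw [← Finset.sum_filter, Finset.sum_const]
      have h1 := hr' L i (Finset.le_sup (f := Int.natAbs) hi)
      rw [← Finset.card_filter] at h1
      rw [← h1]
      push_cast
      rw [add_smul, one_smul, smul_add, smul_comm, Nat.cast_smul_eq_nsmul]
    have hterm : ∀ k, ‖∑ i ∈ t with i ∉ s k, b i • z i‖ ≤ (1 / 2) ^ K * (1 / 2) ^ k := fun k => by
      rcases le_total k K with hk | hk
      · refine (hsum K _ (ht.mono_left (Finset.filter_subset _ _)) b hb).le.trans ?_
        rw [show (1 / 4 : ℝ) = 1 / 2 * (1 / 2) by norm_num, mul_pow]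
        gcongr _ * ?_
        exact pow_le_pow_of_le_one (by norm_num) (by norm_num) hk
      · refine (hsum k _ ?_ b hb).le.trans ?_
        · rw [Finset.disjoint_left]
          exact fun i hi => (Finset.mem_filter.1 hi).2
        rw [show (1 / 4 : ℝ) = 1 / 2 * (1 / 2) by norm_num, mul_pow]
        gcongr ?_ * _
        exact pow_le_pow_of_le_one (by norm_num) (by norm_num) hk
    have hgeom : ∑ k ∈ Finset.range L, (1 / 2 : ℝ) ^ k ≤ 2 := by
      refine le_of_le_of_eq ?_ tsum_geometric_two
      exact summable_geometric_two.sum_le_tsum _ fun _ _ => by positivity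
    have h0 : ‖∑ i ∈ t, b i • z i‖ ≤ (1 / 2) ^ K :=
      (hsum K t ht b hb).le.trans (by gcongr; norm_num)
    rw [hexp]
    calc _ ≤ ‖∑ i ∈ t, b i • z i‖ + ‖∑ k ∈ Finset.range L, ∑ i ∈ t with i ∉ s k, b i • z i‖ :=
          norm_add_le _ _
      _ ≤ (1 / 2) ^ K + ∑ k ∈ Finset.range L, (1 / 2) ^ K * (1 / 2) ^ k :=
          add_le_add h0 ((norm_sum_le _ _).trans (Finset.sum_le_sum fun k _ => hterm k))
      _ ≤ (1 / 2) ^ K * 3 := by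
          rw [← Finset.mul_sum]
          have : (0 : ℝ) ≤ (1 / 2) ^ K := by positivity
          nlinarith

end IsMultiplierSummable

end MultiplierSummable

/-! ### A supercyclic vector with a multiplier summable bilateral orbit -/

section Orbit

variable {𝕜 E : Type*} [RCLike 𝕜] [NormedAddCommGroup E] [Module 𝕜 E]

lemma hasSum_half_pow_tail (k : ℕ) :
    HasSum (fun j : ℕ => (1 / 2 : ℝ) ^ (j + k)) (2 * (1 / 2) ^ k) := by
  have := (hasSum_geometric_two).mul_right ((1 / 2 : ℝ) ^ k)
  simpa only [pow_add] using this

/-- For every vector of the set in the Frequent Hypercyclicity Criterion, its orbit under `T` and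
its backward orbit under `S` form a summable bilateral orbit. -/
lemma SatisfiesFHCriterion.exists_bilateral_orbits {T : E →L[𝕜] E} (hT : SatisfiesFHCriterion T) :
    ∃ E₀ : Set E, Dense E₀ ∧ ∀ y ∈ E₀, ∃ w : ℤ → E, w 0 = y ∧ (∀ n, T (w n) = w (n + 1)) ∧
      Summable w := by
  obtain ⟨E₀, hd, S, h⟩ := hT
  refine ⟨E₀, hd, fun y hy => ?_⟩
  set w : ℤ → E := fun n => Int.casesOn n (fun n => (T ^ n) y) fun n => (S^[n + 1] ⟨y, hy⟩ : E₀)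
    with hw
  refine ⟨w, rfl, fun n => ?_, ?_⟩
  · rcases n with n | n
    · change T ((T ^ n) y) = (T ^ (n + 1)) y
      rw [pow_succ']
      rfl
    · rcases n with _ | n
      · exact (h ⟨y, hy⟩).2.2
      · change T (S^[n + 1 + 1] ⟨y, hy⟩ : E₀) = (S^[n + 1] ⟨y, hy⟩ : E₀)
        rw [Function.iterate_succ_apply', (h _).2.2]
  · refine Summable.of_nat_of_neg_add_one (h ⟨y, hy⟩).1 ?_
    refine ((summable_nat_add_iff 1).2 (h ⟨y, hy⟩).2.1).congr fun n => ?_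
    rw [← Int.negSucc_eq]

variable [ContinuousSMul 𝕜 E]

/-- Given multiplier summable families `w k`, there are scalars `c k`, decaying so fast that each
family `c k • w k` is small even compared with the earlier scalars, and then times `m k`, growing so
fast that at time `m k` the earlier families are small compared with `c k`. -/
lemma exists_scalars_times {w : ℕ → ℤ → E} (hw : ∀ k, IsMultiplierSummable 𝕜 (w k)) :
    ∃ (c : ℕ → 𝕜) (m : ℕ → ℕ), (∀ k, c k ≠ 0) ∧ (∀ k, ‖c k‖ ≤ 1) ∧
      (∀ k (t : Finset ℤ) (b : ℤ → 𝕜), (∀ i, ‖b i‖ ≤ 1) →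
        ‖∑ i ∈ t, (c k * b i) • w k i‖ ≤ (1 / 2) ^ k) ∧
      (∀ j k, j < k → ∀ n, ‖((c j)⁻¹ * c k) • w k n‖ ≤ (1 / 2) ^ k) ∧
      ∀ j k, j < k → ‖((c k)⁻¹ * c j) • w j (m k - m j)‖ ≤ (1 / 2) ^ k := by
  choose δ hδ h using fun k => (hw k).exists_norm_sum_mul_smul_lt
    (show (0 : ℝ) < (1 / 2) ^ k by positivity)
  set γ : ℕ → ℝ := fun k => ∏ i ∈ Finset.range (k + 1), min (δ i) 1 with hγ
  have hmin0 : ∀ i, 0 < min (δ i) 1 := fun i => lt_min (hδ i) one_pos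
  have hγ0 : ∀ k, 0 < γ k := fun k => Finset.prod_pos fun i _ => hmin0 i
  have hquot : ∀ j k, j < k → γ k ≤ γ j * δ k := fun j k hjk => by
    obtain ⟨l, rfl⟩ := Nat.exists_eq_add_of_lt hjk
    simp only [hγ]
    rw [Finset.prod_range_succ]
    refine mul_le_mul ?_ (min_le_left _ _) (hmin0 _).le (hγ0 j).le
    rw [show j + l + 1 = (j + 1) + l by ring, Finset.prod_range_add]
    exact mul_le_of_le_one_right (hγ0 j).le
      (Finset.prod_le_one (fun i _ => (hmin0 _).le) fun i _ => min_le_right _ _)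
  have hγδ : ∀ k, γ k ≤ δ k := fun k => by
    simp only [hγ]
    rw [Finset.prod_range_succ]
    exact (mul_le_of_le_one_left (hmin0 k).le
      (Finset.prod_le_one (fun i _ => (hmin0 _).le) fun i _ => min_le_right _ _)).trans
      (min_le_left _ _)
  have hsmall : ∀ (j k : ℕ), ∃ l : ℕ, ∀ n : ℤ, (l : ℤ) ≤ n →
      ‖((γ k : 𝕜)⁻¹ * (γ j : 𝕜)) • w j n‖ ≤ (1 / 2) ^ k := fun j k => by
    have hc : Tendsto (fun n => ((γ k : 𝕜)⁻¹ * (γ j : 𝕜)) • w j n) cofinite (𝓝 0) := by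
      simpa using (hw j).tendsto_cofinite.const_smul ((γ k : 𝕜)⁻¹ * (γ j : 𝕜))
    have hf := hc (Metric.ball_mem_nhds 0 (show (0 : ℝ) < (1 / 2) ^ k by positivity))
    rw [mem_map, mem_cofinite] at hf
    obtain ⟨B, hB⟩ := hf.bddAbove
    refine ⟨(B + 1).toNat, fun n hn => ?_⟩
    by_contra hcon
    have := hB (show n ∈ _ from fun hmem => hcon (by simpa using (mem_ball_zero_iff.1 hmem).le))
    omega
  choose l hl using hsmall
  set m : ℕ → ℕ := fun k => ∑ i ∈ Finset.range (k + 1), ∑ j ∈ Finset.range i, l j i with hm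
  have hml : ∀ j k, j < k → (l j k : ℤ) ≤ m k - m j := fun j k hjk => by
    have h1 : l j k ≤ ∑ j ∈ Finset.range k, l j k :=
      Finset.single_le_sum (f := fun j => l j k) (fun _ _ => Nat.zero_le _)
        (Finset.mem_range.2 hjk)
    have h2 : m j ≤ ∑ i ∈ Finset.range k, ∑ j ∈ Finset.range i, l j i :=
      Finset.sum_le_sum_of_subset (Finset.range_mono hjk)
    have h3 : m k = ∑ i ∈ Finset.range k, ∑ j ∈ Finset.range i, l j i +
      ∑ j ∈ Finset.range k, l j k := Finset.sum_range_succ _ _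
    omega
  refine ⟨fun k => (γ k : 𝕜), m, fun k => by simpa using (hγ0 k).ne', fun k => ?_,
    fun k t b hb => (h k _ ?_ t b hb).le, fun j k hjk n => ?_,
    fun j k hjk => hl j k _ (hml j k hjk)⟩
  · rw [RCLike.norm_ofReal, abs_of_pos (hγ0 k)]
    exact Finset.prod_le_one (fun i _ => (hmin0 _).le) fun i _ => min_le_right _ _
  · rw [RCLike.norm_ofReal, abs_of_pos (hγ0 k)]
    exact hγδ k
  · have hq : ‖(γ j : 𝕜)⁻¹ * (γ k : 𝕜)‖ ≤ δ k := by
      rw [norm_mul, norm_inv, RCLike.norm_ofReal, RCLike.norm_ofReal, abs_of_pos (hγ0 _),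
        abs_of_pos (hγ0 _), inv_mul_le_iff₀ (hγ0 j)]
      exact hquot j k hjk
    simpa using (h k _ hq {n} (fun _ => 1) (by simp)).le

/-- The superposition of bilateral orbits through a dense sequence of vectors, rescaled and shifted
in time as in `exists_scalars_times`: at time `m k`, rescaled by `(c k)⁻¹`, the sum is close to the
`k`-th vector of the sequence. -/
lemma SatisfiesFHCriterion.exists_multiplierSummable_orbit [CompleteSpace E]
    [TopologicalSpace.SeparableSpace E] [Module ℝ E] [IsScalarTower ℝ 𝕜 E]
    (hE : IsLocallyBoundedTVS 𝕜 E ∨ LocallyConvexSpace ℝ E) {T : E →L[𝕜] E}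
    (hT : SatisfiesFHCriterion T) :
    ∃ z : ℤ → E, (∀ n, T (z n) = z (n + 1)) ∧ IsMultiplierSummable 𝕜 z ∧
      ∀ U : Set E, IsOpen U → U.Nonempty → ∃ (c : 𝕜) (n : ℕ), c • z n ∈ U := by
  classical
  obtain ⟨E₀, hd, hE₀⟩ := hT.exists_bilateral_orbits
  have : Nonempty E₀ := hd.nonempty.to_subtype
  have : SecondCountableTopology E := UniformSpace.secondCountable_of_separable E
  -- a sequence in which each term of a dense sequence of `E₀` recurs infinitely often
  choose w hw0 hwT hws using fun k : ℕ =>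
    hE₀ _ (TopologicalSpace.denseSeq E₀ (Nat.unpair k).1).2
  obtain ⟨c, m, hc0, hc1, hsum, hlate, hearly⟩ :=
    exists_scalars_times (𝕜 := 𝕜) fun k => (hws k).isMultiplierSummable hE
  set f : ℕ → ℤ → E := fun k n => c k • w k (n - m k) with hf
  have hfms : ∀ k, IsMultiplierSummable 𝕜 fun n => w k (n - m k) := fun k =>
    ((hws k).isMultiplierSummable hE).comp_equiv (Equiv.subRight (m k : ℤ))
  have hfsum : ∀ k (t : Finset ℤ) (b : ℤ → 𝕜), (∀ i, ‖b i‖ ≤ 1) →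
      ‖∑ i ∈ t, b i • f k i‖ ≤ (1 / 2) ^ k := fun k t b hb => by
    have := hsum k (t.map (Equiv.subRight (m k : ℤ)).toEmbedding) (fun i => b (i + m k))
      fun i => hb _
    simpa [hf, smul_smul, mul_comm] using this
  have hfn : ∀ k n, ‖f k n‖ ≤ (1 / 2) ^ k := fun k n => by
    simpa using hfsum k {n} (fun _ => 1) (by simp)
  have hfs : ∀ n, Summable fun k => f k n := fun n =>
    Summable.of_norm_bounded summable_geometric_two fun k => hfn k n
  refine ⟨fun n => ∑' k, f k n, fun n => ?_, ?_, ?_⟩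
  · rw [T.map_tsum (hfs n)]
    refine tsum_congr fun k => ?_
    simp only [hf, map_smul, hwT]
    congr 2
    ring
  · intro ε hε
    obtain ⟨K, hK⟩ : ∃ K : ℕ, (1 / 2 : ℝ) ^ K * 4 < ε := by
      obtain ⟨K, hK⟩ := exists_pow_lt_of_lt_one (show 0 < ε / 4 by positivity)
        (show (1 / 2 : ℝ) < 1 by norm_num)
      exact ⟨K, by linarith⟩
    choose s hs using fun k => hfms k ((1 / 2) ^ K * (1 / 2) ^ k) (by positivity)
    refine ⟨(Finset.range K).biUnion s, fun t ht b hb => lt_of_le_of_lt ?_ hK⟩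
    have hsw : ∑ i ∈ t, b i • ∑' k, f k i = ∑' k, ∑ i ∈ t, b i • f k i := by
      rw [Summable.tsum_finsetSum fun i _ => (hfs i).const_smul (b i)]
      exact Finset.sum_congr rfl fun i _ => ((hfs i).tsum_const_smul (b i)).symm
    have hss : Summable fun k => ∑ i ∈ t, b i • f k i :=
      Summable.of_norm_bounded summable_geometric_two fun k => hfsum k t b hb
    have h1 : ‖∑ k ∈ Finset.range K, ∑ i ∈ t, b i • f k i‖ ≤ 2 * (1 / 2) ^ K := by
      calc _ ≤ ∑ k ∈ Finset.range K, ‖∑ i ∈ t, b i • f k i‖ := norm_sum_le _ _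
        _ ≤ ∑ k ∈ Finset.range K, (1 / 2) ^ K * (1 / 2) ^ k := by
          refine Finset.sum_le_sum fun k hk => ?_
          have := hs k t (ht.mono_right (Finset.subset_biUnion_of_mem s hk)) (fun i => b i * c k)
            fun i => by
              rw [norm_mul]
              exact mul_le_one₀ (hb i) (norm_nonneg _) (hc1 k)
          simpa [hf, smul_smul] using this.le
        _ ≤ 2 * (1 / 2) ^ K := by
          rw [← Finset.mul_sum, mul_comm]
          gcongr
          refine le_of_le_of_eq ?_ tsum_geometric_two
          exact summable_geometric_two.sum_le_tsum _ fun _ _ => by positivity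
    have h2 : ‖∑' k, ∑ i ∈ t, b i • f (k + K) i‖ ≤ 2 * (1 / 2) ^ K :=
      tsum_of_norm_bounded (hasSum_half_pow_tail K) fun k => hfsum (k + K) t b hb
    rw [hsw, ← hss.sum_add_tsum_nat_add K]
    exact (norm_add_le _ _).trans (by linarith)
  · -- the distance of `(c k)⁻¹ • z (m k)` to the `k`-th vector
    have hdist : ∀ k, ‖(c k)⁻¹ • (∑' j, f j (m k)) - w k 0‖ ≤ (k + 1) * (1 / 2) ^ k := fun k => by
      have hg : ∀ j, (c k)⁻¹ • f j (m k) = ((c k)⁻¹ * c j) • w j (m k - m j) := fun j => by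
        simp only [hf, smul_smul]
      have hgs : Summable fun j => (c k)⁻¹ • f j (m k) := (hfs _).const_smul _
      have hk : (c k)⁻¹ • f k (m k) = w k 0 := by
        rw [hg, inv_mul_cancel₀ (hc0 k), one_smul, sub_self]
      have h1 : ‖∑ j ∈ Finset.range k, (c k)⁻¹ • f j (m k)‖ ≤ k * (1 / 2) ^ k := by
        calc _ ≤ ∑ j ∈ Finset.range k, ‖(c k)⁻¹ • f j (m k)‖ := norm_sum_le _ _
          _ ≤ ∑ j ∈ Finset.range k, (1 / 2) ^ k := Finset.sum_le_sum fun j hj => by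
            rw [hg]
            exact hearly j k (Finset.mem_range.1 hj)
          _ = _ := by simp
      have h2 : ‖∑' j, (c k)⁻¹ • f (j + (k + 1)) (m k)‖ ≤ 2 * (1 / 2) ^ (k + 1) := by
        refine tsum_of_norm_bounded (hasSum_half_pow_tail (k + 1)) fun j => ?_
        rw [hg]
        exact hlate k _ (by omega) _
      rw [← (hfs _).tsum_const_smul, ← hgs.sum_add_tsum_nat_add (k + 1), Finset.sum_range_succ, hk,
        add_right_comm, add_sub_cancel_right]
      refine (norm_add_le _ _).trans ((add_le_add h1 h2).trans (le_of_eq ?_))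
      ring
    have hlim : Tendsto (fun k : ℕ => ((k : ℝ) + 1) * (1 / 2) ^ k) atTop (𝓝 0) := by
      have h1 := tendsto_self_mul_const_pow_of_lt_one (show (0 : ℝ) ≤ 1 / 2 by norm_num)
        (by norm_num)
      have h2 := tendsto_pow_atTop_nhds_zero_of_lt_one (show (0 : ℝ) ≤ 1 / 2 by norm_num)
        (by norm_num)
      simpa [add_mul] using h1.add h2
    intro U hU hne
    obtain ⟨y, hyU, hy⟩ := hd.inter_open_nonempty U hU hne
    obtain ⟨i, hi⟩ := (TopologicalSpace.denseRange_denseSeq E₀).exists_mem_open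
      (hU.preimage continuous_subtype_val) ⟨⟨y, hy⟩, hyU⟩
    obtain ⟨ε, hε, hεU⟩ := Metric.isOpen_iff.1 hU _ hi
    obtain ⟨K, hK⟩ := eventually_atTop.1 (hlim.eventually (gt_mem_nhds hε))
    have hk := hK (Nat.pair i K) (Nat.right_le_pair i K)
    refine ⟨(c (Nat.pair i K))⁻¹, m (Nat.pair i K), hεU ?_⟩
    rw [mem_ball_iff_norm]
    have := (hdist (Nat.pair i K)).trans_lt hk
    rwa [hw0, Nat.unpair_pair] at this

end Orbit

/-! ### The law of the coefficients -/

/-- A fully supported law which puts so little mass far away that independent samples are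
eventually dominated by given weights tending to infinity. It is purely atomic, with atoms at a
dense sequence `q j` and masses proportional to `2⁻ʲ / (1 + #{n | a n < ‖q j‖})`. -/
lemma exists_fullSupport_measure_tsum_ne_top {𝕜 : Type*} [RCLike 𝕜] {a : ℤ → ℝ}
    (ha : Tendsto a cofinite atTop) : ∃ ν : Measure 𝕜, IsProbabilityMeasure ν ∧
      ν.IsOpenPosMeasure ∧ ∑' n, ν {x | ¬ ‖x‖ ≤ a n} ≠ ⊤ := by
  classical
  set q : ℕ → 𝕜 := TopologicalSpace.denseSeq 𝕜
  have hfin : ∀ j, {n | ¬ ‖q j‖ ≤ a n}.Finite := fun j =>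
    mem_cofinite.1 (ha.eventually_ge_atTop ‖q j‖)
  set c : ℕ → ℕ := fun j => (hfin j).toFinset.card
  set r : ℕ → ENNReal := fun j => 2⁻¹ ^ j / (1 + c j) with hr
  have hc : ∀ j, (1 + c j : ENNReal) ≠ 0 := fun j => by simp
  have hc' : ∀ j, (1 + c j : ENNReal) ≠ ⊤ := fun j => by simp
  have hr0 : ∀ j, r j ≠ 0 := fun j => ENNReal.div_ne_zero.2 ⟨by simp, hc' j⟩
  have hgeom : ∑' j : ℕ, (2⁻¹ : ENNReal) ^ j ≠ ⊤ := by
    rw [ENNReal.tsum_geometric]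
    simp
  have hrc : ∀ j, r j * c j ≤ 2⁻¹ ^ j := fun j => by
    calc r j * c j ≤ r j * (1 + c j) := by gcongr; exact le_add_self
      _ = 2⁻¹ ^ j := ENNReal.div_mul_cancel (hc j) (hc' j)
  have hrle : ∀ j, r j ≤ 2⁻¹ ^ j := fun j => ENNReal.div_le_of_le_mul (by
    rw [mul_add, mul_one]; exact le_self_add)
  set μ : Measure 𝕜 := Measure.sum fun j => r j • Measure.dirac (q j) with hμ
  have hμapp : ∀ s, MeasurableSet s → μ s = ∑' j, r j * s.indicator 1 (q j) := fun s hs => by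
    rw [hμ, Measure.sum_apply _ hs]
    simp [Measure.dirac_apply' _ hs]
  have hμq : ∀ s, MeasurableSet s → ∀ j, q j ∈ s → μ s ≠ 0 := fun s hs j hj => by
    rw [hμapp s hs]
    intro h
    have := ENNReal.tsum_eq_zero.1 h j
    simp [hj, hr0] at this
  have hfinite : IsFiniteMeasure μ := ⟨by
    rw [hμapp _ MeasurableSet.univ]
    simp only [Set.indicator_univ, Pi.one_apply, mul_one]
    exact (ENNReal.tsum_le_tsum hrle).trans_lt hgeom.lt_top⟩
  have hne : NeZero μ := ⟨fun h => hμq Set.univ MeasurableSet.univ 0 (Set.mem_univ _) (by simp [h])⟩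
  have hinv : (μ Set.univ)⁻¹ ≠ 0 := ENNReal.inv_ne_zero.2 (measure_ne_top _ _)
  refine ⟨(μ Set.univ)⁻¹ • μ, inferInstance, ⟨fun U hU hUne => ?_⟩, ?_⟩
  · obtain ⟨j, hj⟩ := (TopologicalSpace.denseRange_denseSeq 𝕜).exists_mem_open hU hUne
    rw [Measure.smul_apply, smul_eq_mul]
    exact mul_ne_zero hinv (hμq U hU.measurableSet j hj)
  · have hms : ∀ n, MeasurableSet {x : 𝕜 | ¬ ‖x‖ ≤ a n} := fun n =>
      (measurableSet_le measurable_norm measurable_const).compl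
    simp only [Measure.smul_apply, smul_eq_mul]
    rw [ENNReal.tsum_mul_left]
    refine ENNReal.mul_ne_top (ENNReal.inv_ne_top.2 (NeZero.ne _)) (ne_top_of_le_ne_top hgeom ?_)
    calc ∑' n, μ {x | ¬ ‖x‖ ≤ a n}
        = ∑' n, ∑' j, r j * {x : 𝕜 | ¬ ‖x‖ ≤ a n}.indicator 1 (q j) :=
          tsum_congr fun n => hμapp _ (hms n)
      _ = ∑' j, ∑' n, r j * {x : 𝕜 | ¬ ‖x‖ ≤ a n}.indicator 1 (q j) := ENNReal.tsum_comm
      _ = ∑' j, r j * c j := by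
          refine tsum_congr fun j => ?_
          rw [ENNReal.tsum_mul_left]
          congr 1
          rw [tsum_eq_sum (s := (hfin j).toFinset) fun n hn => by
            simpa [Set.indicator_apply] using hn]
          rw [Finset.sum_congr rfl fun n hn => show _ = (1 : ENNReal) by
            simpa [Set.indicator_apply] using hn]
          simp [c]
      _ ≤ _ := ENNReal.tsum_le_tsum hrc

lemma one_le_prod_add_sum {ι : Type*} (r : Finset ι) {x p : ι → ENNReal} (hx : ∀ i, x i ≤ 1)
    (h : ∀ i, 1 ≤ x i + p i) : 1 ≤ ∏ i ∈ r, x i + ∑ i ∈ r, p i := by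
  classical
  induction r using Finset.induction_on with
  | empty => simp
  | insert i r hi ih =>
    rw [Finset.prod_insert hi, Finset.sum_insert hi]
    calc 1 ≤ x i * 1 + p i := by simpa using h i
      _ ≤ x i * (∏ i ∈ r, x i + ∑ i ∈ r, p i) + p i := by gcongr
      _ ≤ x i * ∏ i ∈ r, x i + 1 * ∑ i ∈ r, p i + p i := by
          rw [mul_add]
          gcongr
          exact hx i
      _ = _ := by ring

lemma infinitePi_univ_pi_ne_zero {ι : Type*} [Countable ι] {X : ι → Type*}
    [∀ i, MeasurableSpace (X i)] (ν : ∀ i, Measure (X i)) [∀ i, IsProbabilityMeasure (ν i)]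
    {t : ∀ i, Set (X i)} (ht : ∀ i, MeasurableSet (t i)) (h0 : ∀ i, ν i (t i) ≠ 0)
    (hsum : ∑' i, ν i (t i)ᶜ ≠ ⊤) : Measure.infinitePi ν (Set.univ.pi t) ≠ 0 := by
  classical
  obtain ⟨s, hs⟩ := ((ENNReal.tendsto_tsum_compl_atTop_zero hsum).eventually
    (gt_mem_nhds (show (0 : ENNReal) < 2⁻¹ by simp))).exists
  have hle : ∀ i, ν i (t i) ≤ 1 := fun i => prob_le_one
  have hpos : (∏ i ∈ s, ν i (t i)) * 2⁻¹ ≠ 0 :=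
    mul_ne_zero (Finset.prod_ne_zero_iff.2 fun i _ => h0 i) (by simp)
  rw [Measure.infinitePi_pi_univ _ ht, ENNReal.tprod_eq_iInf_prod hle]
  refine ne_of_gt ((pos_iff_ne_zero.2 hpos).trans_le (le_iInf fun r => ?_))
  have htail : 2⁻¹ ≤ ∏ i ∈ r \ s, ν i (t i) := by
    have h1 := one_le_prod_add_sum (r \ s) hle (p := fun i => ν i (t i)ᶜ) fun i => by
      rw [prob_add_prob_compl (ht i)]
    have h2 : ∑ i ∈ r \ s, ν i (t i)ᶜ ≤ 2⁻¹ := by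
      refine le_trans ?_ hs.le
      have := ENNReal.sum_le_tsum (f := fun b : {x // x ∉ s} => ν b (t b)ᶜ)
        ((r \ s).subtype fun i => i ∉ s)
      rwa [Finset.sum_subtype_of_mem (fun i => ν i (t i)ᶜ)
        fun i hi => (Finset.mem_sdiff.1 hi).2] at this
    have h3 : (1 : ENNReal) ≤ ∏ i ∈ r \ s, ν i (t i) + 2⁻¹ := h1.trans (by gcongr)
    rw [← ENNReal.inv_two_add_inv_two] at h3
    exact (ENNReal.add_le_add_iff_right (by simp)).1 h3
  calc (∏ i ∈ s, ν i (t i)) * 2⁻¹ ≤ (∏ i ∈ s, ν i (t i)) * ∏ i ∈ r \ s, ν i (t i) := by gcongr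
    _ = ∏ i ∈ s ∪ r \ s, ν i (t i) := (Finset.prod_union Finset.disjoint_sdiff).symm
    _ ≤ ∏ i ∈ r, ν i (t i) :=
        Finset.prod_le_prod_of_subset_of_le_one' (by intro i hi; by_cases i ∈ s <;> simp [*])
          fun i _ _ => hle i

/-! ### Random series along a bilateral orbit -/

/-- The sum of the series `∑ ξₙ zₙ` over `n ∈ ℤ`, with the junk value `0` where it does not converge
unconditionally. -/
noncomputable def bilateralSeries {𝕜 E : Type*} [RCLike 𝕜] [NormedAddCommGroup E] [Module 𝕜 E]
    (z : ℤ → E) (ξ : ℤ → 𝕜) : E :=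
  ∑' n, ξ n • z n

section RandomSeries

variable {𝕜 E : Type*} [RCLike 𝕜] [NormedAddCommGroup E] [Module 𝕜 E] {z : ℤ → E}

lemma bilateralSeries_bilateralShift {T : E →L[𝕜] E} (hT : ∀ n, T (z n) = z (n + 1)) {ξ : ℤ → 𝕜}
    (hξ : Summable fun n => ξ n • z n) :
    bilateralSeries z (bilateralShift 𝕜 ξ) = T (bilateralSeries z ξ) := by
  unfold bilateralSeries
  rw [T.map_tsum hξ, ← (Equiv.addRight (1 : ℤ)).tsum_eq]
  exact tsum_congr fun n => by simp [bilateralShift, hT]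

lemma aemeasurable_bilateralSeries [ContinuousSMul 𝕜 E]
    [TopologicalSpace.SeparableSpace E] [MeasurableSpace E] [BorelSpace E] {ν : Measure 𝕜}
    (h : ∀ᵐ ξ ∂(Measure.infinitePi fun _ : ℤ => ν), Summable fun n => ξ n • z n) :
    AEMeasurable (bilateralSeries z) (Measure.infinitePi fun _ : ℤ => ν) := by
  have : SecondCountableTopology E := UniformSpace.secondCountable_of_separable E
  refine aemeasurable_of_tendsto_metrizable_ae (atTop : Filter (Finset ℤ))
    (f := fun s ξ => ∑ i ∈ s, ξ i • z i) (fun s => ?_) (h.mono fun ξ hξ => by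
      simpa only [HasSum, SummationFilter.unconditional_filter, bilateralSeries] using hξ.hasSum)
  refine Measurable.aemeasurable (Finset.measurable_sum _ fun i _ => ?_)
  have hc : Continuous fun x : 𝕜 => x • z i := by fun_prop
  exact hc.measurable.comp (measurable_pi_apply i)

variable [CompleteSpace E] {a : ℤ → ℝ}

/-- Coefficients eventually dominated by admissible weights give a convergent series. -/
lemma IsMultiplierSummable.summable_smul_of_weights (ha : ∀ i, 1 ≤ a i)
    (hz : IsMultiplierSummable 𝕜 fun i => (a i : 𝕜) • z i) {ξ : ℤ → 𝕜}
    (hξ : {n | ¬ ‖ξ n‖ ≤ a n}.Finite) : Summable fun n => ξ n • z n := by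
  have ha0 : ∀ i, 0 < a i := fun i => one_pos.trans_le (ha i)
  have := hz.summable_smul (b := fun n => ξ n * (a n : 𝕜)⁻¹) (hξ.subset fun n hn h => hn (by
    rw [norm_mul, norm_inv, RCLike.norm_ofReal, abs_of_pos (ha0 n), mul_inv_le_iff₀ (ha0 n)]
    simpa using h))
  refine this.congr fun n => ?_
  rw [smul_smul, mul_assoc, inv_mul_cancel₀ (by simpa using (ha0 n).ne'), mul_one]

variable {ν : Measure 𝕜} [IsProbabilityMeasure ν]

lemma ae_summable_smul (ha : ∀ i, 1 ≤ a i)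
    (hz : IsMultiplierSummable 𝕜 fun i => (a i : 𝕜) • z i)
    (hν : ∑' n, ν {x | ¬ ‖x‖ ≤ a n} ≠ ⊤) :
    ∀ᵐ ξ ∂(Measure.infinitePi fun _ : ℤ => ν), Summable fun n => ξ n • z n := by
  have h : ∀ n, Measure.infinitePi (fun _ : ℤ => ν) {ξ | ¬ ‖ξ n‖ ≤ a n} = ν {x | ¬ ‖x‖ ≤ a n} :=
    fun n => (measurePreserving_eval_infinitePi (fun _ : ℤ => ν) n).measure_preimage
      ((measurableSet_le measurable_norm measurable_const).compl).nullMeasurableSet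
  filter_upwards [ae_finite_setOfPred_mem (μ := Measure.infinitePi fun _ : ℤ => ν)
    (s := fun n => {ξ | ¬ ‖ξ n‖ ≤ a n}) (by simpa only [h] using hν)] with ξ hξ
  exact hz.summable_smul_of_weights ha hξ

variable [ContinuousSMul 𝕜 E] [TopologicalSpace.SeparableSpace E] [MeasurableSpace E]
  [BorelSpace E]

/-- If the multiples of the vectors `z n` are dense, then the law of the random series has full
support: to come close to `c • z n₀` it suffices that the `n₀`-th coefficient is close to `c`, that
finitely many others are close to `0`, and that the remaining ones are dominated by the weights. -/
lemma isOpenPosMeasure_map_bilateralSeries [ν.IsOpenPosMeasure] (ha : ∀ i, 1 ≤ a i)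
    (hz : IsMultiplierSummable 𝕜 fun i => (a i : 𝕜) • z i)
    (hν : ∑' n, ν {x | ¬ ‖x‖ ≤ a n} ≠ ⊤)
    (hd : ∀ U : Set E, IsOpen U → U.Nonempty → ∃ (c : 𝕜) (n : ℤ), c • z n ∈ U) :
    ((Measure.infinitePi fun _ : ℤ => ν).map (bilateralSeries z)).IsOpenPosMeasure := by
  classical
  have hae := ae_summable_smul ha hz hν
  have ha0 : ∀ i, 0 < a i := fun i => one_pos.trans_le (ha i)
  refine ⟨fun U hU hUne => ?_⟩
  rw [Measure.map_apply_of_aemeasurable (aemeasurable_bilateralSeries hae) hU.measurableSet]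
  obtain ⟨c, n₀, hc⟩ := hd U hU hUne
  obtain ⟨ε, hε, hεU⟩ := Metric.isOpen_iff.1 hU _ hc
  obtain ⟨s₀, hs₀⟩ := hz (ε / 2) (half_pos hε)
  set s := insert n₀ s₀ with hs
  obtain ⟨δ, hδ, hhead⟩ := exists_norm_sum_smul_lt (𝕜 := 𝕜) s z (half_pos hε)
  set e : ℤ → 𝕜 := fun i => if i = n₀ then c else 0 with he
  set t : ℤ → Set 𝕜 := fun i => if i ∈ s then Metric.closedBall (e i) δ else {x | ‖x‖ ≤ a i} with ht
  have htm : ∀ i, MeasurableSet (t i) := fun i => by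
    simp only [ht]
    split_ifs
    · exact measurableSet_closedBall
    · exact measurableSet_le measurable_norm measurable_const
  have ht0 : ∀ i, ν (t i) ≠ 0 := fun i => by
    simp only [ht]
    split_ifs
    · exact ((Metric.measure_ball_pos ν (e i) hδ).trans_le
        (measure_mono Metric.ball_subset_closedBall)).ne'
    · refine ((Metric.measure_ball_pos ν (0 : 𝕜) one_pos).trans_le
        (measure_mono fun x hx => ?_)).ne'
      exact (mem_ball_zero_iff.1 hx).le.trans (ha i)
  have htsum : ∑' i, ν (t i)ᶜ ≠ ⊤ := by
    have hle : ∀ i, ν (t i)ᶜ ≤ (if i ∈ s then 1 else 0) + ν {x | ¬ ‖x‖ ≤ a i} := fun i => by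
      simp only [ht]
      split_ifs
      · exact prob_le_one.trans le_self_add
      · rw [zero_add]; rfl
    refine ne_top_of_le_ne_top ?_ (ENNReal.tsum_le_tsum hle)
    rw [ENNReal.tsum_add, tsum_eq_sum (s := s) fun i hi => by simp [hi]]
    exact ENNReal.add_ne_top.2 ⟨by simp, hν⟩
  refine fun h0 => infinitePi_univ_pi_ne_zero (fun _ : ℤ => ν) htm ht0 htsum
    (measure_mono_null (fun ξ hξ => hεU ?_) h0)
  have hξin : ∀ i ∈ s, ‖ξ i - e i‖ ≤ δ := fun i hi => by
    have := hξ i (Set.mem_univ i)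
    simpa [ht, hi, dist_eq_norm] using this
  have hξout : ∀ i, i ∉ s → ‖ξ i‖ ≤ a i := fun i hi => by
    have := hξ i (Set.mem_univ i)
    simpa [ht, hi] using this
  have hξs : Summable fun n => ξ n • z n := hz.summable_smul_of_weights ha
    (s.finite_toSet.subset fun i hi => by_contra fun his => hi (hξout i his))
  have hes : HasSum (fun n => e n • z n) (c • z n₀) := by
    have := hasSum_ite_eq n₀ (c • z n₀)
    refine this.congr_fun fun n => ?_
    simp only [he]
    split_ifs with h <;> simp [h]
  have hdiff : HasSum (fun n => (ξ n - e n) • z n) (bilateralSeries z ξ - c • z n₀) := by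
    simpa only [sub_smul, bilateralSeries] using hξs.hasSum.sub hes
  rw [mem_ball_iff_norm]
  have hA := hhead (fun i => ξ i - e i) hξin
  refine lt_of_le_of_lt (b := ‖∑ i ∈ s, (ξ i - e i) • z i‖ + ε / 2) ?_ (by linarith)
  refine le_of_tendsto hdiff.norm ?_
  filter_upwards [eventually_ge_atTop s] with r hr
  rw [← Finset.sum_sdiff hr, add_comm]
  refine (norm_add_le _ _).trans (add_le_add_right ?_ _)
  have := hs₀ (r \ s) (Finset.sdiff_disjoint.mono_right (Finset.subset_insert _ _))
    (fun i => if i ∈ s then 0 else ξ i * (a i : 𝕜)⁻¹) fun i => by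
      split_ifs with hi
      · simp
      · rw [norm_mul, norm_inv, RCLike.norm_ofReal, abs_of_pos (ha0 i), mul_inv_le_iff₀ (ha0 i),
          one_mul]
        exact hξout i hi
  refine le_trans (le_of_eq ?_) this.le
  congr 1
  refine Finset.sum_congr rfl fun i hi => ?_
  have hi' := (Finset.mem_sdiff.1 hi).2
  have hne : i ≠ n₀ := fun h => hi' (h ▸ Finset.mem_insert_self _ _)
  simp only [he, hi', hne, if_false, sub_zero, smul_smul]
  rw [mul_assoc, inv_mul_cancel₀ (by simpa using (ha0 i).ne'), mul_one]

end RandomSeries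

/-! ### Frequently hypercyclic random vectors -/

lemma lowerDensity_mono {A B : Set ℕ} (h : A ⊆ B) : lowerDensity A ≤ lowerDensity B := by
  have hle : ∀ (C : Set ℕ) (N : ℕ), ((C ∩ Set.Iic N).ncard : ℝ) / ((N : ℝ) + 1) ≤ 1 := fun C N => by
    refine div_le_one_of_le₀ ?_ (by positivity)
    have := Set.ncard_le_ncard (Set.inter_subset_right : C ∩ Set.Iic N ⊆ _) (Set.finite_Iic N)
    rw [← Finset.coe_Iic, Set.ncard_coe_finset, Nat.card_Iic] at this
    exact_mod_cast this
  refine liminf_le_liminf (Eventually.of_forall fun N => ?_)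
    ⟨0, eventually_map.2 (Eventually.of_forall fun N => by positivity)⟩
    (IsBoundedUnder.isCoboundedUnder_ge ⟨1, eventually_map.2 (Eventually.of_forall (hle B))⟩)
  gcongr
  exact (Set.finite_Iic N).inter_of_right B

section FrequentHypercyclicity

variable {𝕜 E : Type*} [RCLike 𝕜] [NormedAddCommGroup E] [Module 𝕜 E]

/-- Almost every vector for a strongly mixing invariant law of full support is frequently
hypercyclic, as only the countably many sets of a basis have to be visited. -/
lemma IsStronglyMixing.ae_isFreqHypercyclicVector [TopologicalSpace.SeparableSpace E]
    [MeasurableSpace E] [BorelSpace E] {T : E →L[𝕜] E} {μ : Measure E} [IsProbabilityMeasure μ]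
    [μ.IsOpenPosMeasure] (h : IsStronglyMixing T μ) : ∀ᵐ y ∂μ, IsFreqHypercyclicVector T y := by
  have : SecondCountableTopology E := UniformSpace.secondCountable_of_separable E
  have hall : ∀ᵐ y ∂μ, ∀ U ∈ TopologicalSpace.countableBasis E,
      0 < lowerDensity {n : ℕ | T^[n] y ∈ U} := by
    refine (ae_ball_iff (TopologicalSpace.countable_countableBasis E)).2 fun U hU => ?_
    have hUo := TopologicalSpace.isOpen_of_mem_countableBasis hU
    exact h.ae_lowerDensity_pos hUo.measurableSet
      (hUo.measure_ne_zero μ (TopologicalSpace.nonempty_of_mem_countableBasis hU))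
  filter_upwards [hall] with y hy U hU ⟨x, hx⟩
  obtain ⟨V, hV, -, hVU⟩ :=
    (TopologicalSpace.isBasis_countableBasis E).exists_subset_of_mem_open hx hU
  refine (hy V hV).trans_le (lowerDensity_mono fun n hn => hVU ?_)
  rw [FunLike.coe_pow_eq_iterate]
  exact hn

lemma isTwoSidedSum_tsum [CompleteSpace E] {f : ℤ → E} (hf : Summable f) :
    IsTwoSidedSum (fun n : ℕ => f n) (fun n : ℕ => f (-(n : ℤ))) (∑' n, f n) := by
  have h1 : Summable fun n : ℕ => f n := hf.comp_injective Nat.cast_injective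
  have h2 : Summable fun n : ℕ => f (-((n : ℤ) + 1)) :=
    hf.comp_injective fun a b h => by simpa using h
  refine ⟨_, _, h1.hasSum.tendsto_sum_nat, ?_, tsum_of_nat_of_neg_add_one h1 h2⟩
  refine h2.hasSum.tendsto_sum_nat.congr fun N => ?_
  rw [← Finset.Ico_add_one_right_eq_Icc, Finset.sum_Ico_eq_sum_range]
  refine Finset.sum_congr rfl fun n _ => ?_
  push_cast
  rw [add_comm]

lemma pow_apply_orbit {T : E →L[𝕜] E} {z : ℤ → E} (hT : ∀ n, T (z n) = z (n + 1)) (n : ℕ) :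
    (T ^ n) (z 0) = z n := by
  induction n with
  | zero => simp
  | succ n ih =>
    rw [pow_succ']
    change T ((T ^ n) (z 0)) = _
    rw [ih, hT]
    push_cast
    rfl

end FrequentHypercyclicity

theorem mainTheorem1 {𝕜 : Type*} [RCLike 𝕜]
    {E : Type*} [NormedAddCommGroup E] [Module 𝕜 E] [ContinuousSMul 𝕜 E] [CompleteSpace E]
    [TopologicalSpace.SeparableSpace E] [Module ℝ E] [IsScalarTower ℝ 𝕜 E]
    [MeasurableSpace E] [BorelSpace E]
    (hE : IsLocallyBoundedTVS 𝕜 E ∨ LocallyConvexSpace ℝ E)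
    (T : E →L[𝕜] E) (hT : SatisfiesFHCriterion T) :
    ∃ (x : E) (u : ℕ → E) (ν : Measure 𝕜),
      IsSupercyclicVector T x ∧
      u 0 = x ∧ (∀ n : ℕ, 1 ≤ n → T (u n) = u (n - 1)) ∧
      IsProbabilityMeasure ν ∧ ν.IsOpenPosMeasure ∧
      ∀ {Ω : Type*} [MeasurableSpace Ω] (P : Measure Ω) [IsProbabilityMeasure P]
        (X : ℤ → Ω → 𝕜), iIndepFun X P → (∀ n : ℤ, HasLaw (X n) ν P) →
        ∃ v : Ω → E, AEMeasurable v P ∧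
          (∀ᵐ ω ∂P, IsTwoSidedSum (fun n : ℕ => X (n : ℤ) ω • (T ^ n) x)
            (fun n : ℕ => X (-(n : ℤ)) ω • u n) (v ω)) ∧
          (∀ᵐ ω ∂P, IsFreqHypercyclicVector T (v ω)) ∧
          IsStronglyMixing T (P.map v) ∧
          (P.map v).IsOpenPosMeasure := by
  obtain ⟨z, hTz, hz, hd⟩ := hT.exists_multiplierSummable_orbit hE
  obtain ⟨a, ha1, ha, haz⟩ := hz.exists_weights
  obtain ⟨ν, hν, hνpos, hνsum⟩ := exists_fullSupport_measure_tsum_ne_top (𝕜 := 𝕜) ha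
  have hpow := pow_apply_orbit hTz
  refine ⟨z 0, fun n => z (-n), ν, ?_, by simp, fun n hn => ?_, hν, hνpos, ?_⟩
  · rw [IsSupercyclicVector, dense_iff_inter_open]
    intro U hU hne
    obtain ⟨c, n, hc⟩ := hd U hU hne
    exact ⟨_, hc, c, n, by rw [hpow]⟩
  · rw [hTz]
    congr 1
    omega
  intro Ω _ P _ X hX hlaw
  have hY : AEMeasurable (fun ω n => X n ω) P :=
    aemeasurable_pi_iff.2 fun n => (hlaw n).aemeasurable
  have hmap : P.map (fun ω n => X n ω) = Measure.infinitePi fun _ : ℤ => ν :=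
    (hX.hasLaw_infinitePi hlaw hY).map_eq
  have hae := ae_summable_smul ha1 haz hνsum
  have hF := aemeasurable_bilateralSeries hae
  have hF' : AEMeasurable (bilateralSeries z) (P.map fun ω n => X n ω) := by rwa [hmap]
  have hv : AEMeasurable (fun ω => bilateralSeries z fun n => X n ω) P := hF'.comp_aemeasurable hY
  have hvmap : P.map (fun ω => bilateralSeries z fun n => X n ω) =
      (Measure.infinitePi fun _ : ℤ => ν).map (bilateralSeries z) := by
    rw [← hmap, AEMeasurable.map_map_of_aemeasurable hF' hY]
    rfl
  have hmix : IsStronglyMixing T (P.map fun ω => bilateralSeries z fun n => X n ω) := by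
    rw [hvmap]
    exact (isStronglyMixing_bilateralShift ν).factor T.continuous.measurable hF
      (hae.mono fun ξ hξ => bilateralSeries_bilateralShift hTz hξ)
  have hpos : (P.map fun ω => bilateralSeries z fun n => X n ω).IsOpenPosMeasure := by
    rw [hvmap]
    refine isOpenPosMeasure_map_bilateralSeries ha1 haz hνsum fun U hU hne => ?_
    obtain ⟨c, n, hc⟩ := hd U hU hne
    exact ⟨c, n, hc⟩
  have hprob := Measure.isProbabilityMeasure_map (μ := P) hv
  refine ⟨_, hv, ?_, ae_of_ae_map hv hmix.ae_isFreqHypercyclicVector, hmix, hpos⟩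
  rw [← hmap] at hae
  filter_upwards [ae_of_ae_map hY hae] with ω hω
  simp only [hpow]
  exact isTwoSidedSum_tsum hω
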